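/- Let $n\ge 2$ and $1\le k\le n-1$. Let $\mathrm{GL}_k\times\mathrm{GL}_{n-k}\subset \mathrm{GL}_n(\mathbb R)$ and $\mathrm{O}_k\times\mathrm{O}_{n-k}\subset \mathrm{O}_n$ be the subgroups of block diagonal matrices, and equip $Y=\mathrm{GL}_n(\mathbb R)/(\mathrm{GL}_k\times\mathrm{GL}_{n-k})$ and $X=\mathrm{O}_n/(\mathrm{O}_k\times\mathrm{O}_{n-k})$ with their canonical real analytic manifold structures (those on the quotient topological spaces for which the quotient maps from $\mathrm{GL}_n(\mathbb R)$ and $\mathrm{O}_n$ are analytic submersions). Let $\upsilon:Y\to X$ be the map induced by the Gram–Schmidt process on the columns of matrices. Let $P_k$ be the diagonal matrix whose first $k$ diagonal entries are $1$ and whose other entries are $0$. The map $[W]\mapsto WP_kW^{-1}$ is injective on $Y$, and for $x=[V]\in X$ it maps the fibre $\upsilon^{-1}(x)$ onto the set of idempotent matrices with the same range as the orthogonal projection $VP_kV^{T}$ (an affine space of matrices). Let $\upsilon^{-1}(x)$ carry the real vector space structure induced from this affine space with $VP_kV^{T}$ as origin. Then: 1. $(Y,X,\upsilon)$ is a locally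 trivial real analytic vector bundle: $X$ and $Y$ are Hausdorff analytic manifolds, $\upsilon$ is an analytic surjection, and around all points of $X$ there are bi-analytic, fibrewise linear local trivialisations with model fibre $\mathbb R^{(n-k)\times k}$, whose transition functions are analytic as operator-valued maps. 2. There is a bi-analytic bijection $\Phi$ from the total space of the tangent bundle $TX$ onto $Y$ such that $\upsilon\circ\Phi$ is the bundle projection $TX\to X$ and such that $\Phi$ restricts, for every $x\in X$, to a linear map $T_xX\to\upsilon^{-1}(x)$. -/

import Mathlib

open scoped Manifold ContDiff Matrix Topology

namespace GramSchmidtBundle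

/-! ### The groups and the homogeneous spaces -/

/-- The lower left block (rows of index `≥ k`, columns of index `< k`) vanishes. -/
def IsBlockUpper {n : ℕ} (k : ℕ) (M : Matrix (Fin n) (Fin n) ℝ) : Prop :=
  ∀ i j : Fin n, ¬ i.1 < k → j.1 < k → M i j = 0

/-- `M` is block diagonal with one block of size `k` and one of size `n - k`: both off-diagonal
blocks vanish. -/
def IsBlockDiag {n : ℕ} (k : ℕ) (M : Matrix (Fin n) (Fin n) ℝ) : Prop :=
  ∀ i j : Fin n, ¬ (i.1 < k ↔ j.1 < k) → M i j = 0

theorem isBlockDiag_iff {n : ℕ} {k : ℕ} {M : Matrix (Fin n) (Fin n) ℝ} :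
    IsBlockDiag k M ↔ IsBlockUpper k M ∧ IsBlockUpper k Mᵀ := by
  constructor
  · intro h
    exact ⟨fun i j hi hj => h i j (by tauto), fun i j hi hj => h j i (by tauto)⟩
  · rintro ⟨h1, h2⟩ i j hij
    by_cases hi : i.1 < k
    · exact h2 j i (by tauto) hi
    · exact h1 i j hi (by tauto)

theorem isBlockUpper_iff {n : ℕ} {k : ℕ} {M : Matrix (Fin n) (Fin n) ℝ} :
    IsBlockUpper k M ↔ M.BlockTriangular (fun i : Fin n => decide (k ≤ i.1)) := by
  constructor
  · intro h i j hij
    rw [Bool.lt_iff] at hij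
    simp only [decide_eq_false_iff_not, decide_eq_true_eq] at hij
    exact h i j (by omega) (by omega)
  · intro h i j hi hj
    refine h ?_
    rw [Bool.lt_iff]
    simp only [decide_eq_false_iff_not, decide_eq_true_eq]
    omega

theorem IsBlockUpper.mul {n : ℕ} {k : ℕ} {M N : Matrix (Fin n) (Fin n) ℝ}
    (hM : IsBlockUpper k M) (hN : IsBlockUpper k N) : IsBlockUpper k (M * N) :=
  isBlockUpper_iff.2 ((isBlockUpper_iff.1 hM).mul (isBlockUpper_iff.1 hN))

theorem IsBlockUpper.inv {n : ℕ} {k : ℕ} (g : GL (Fin n) ℝ) (h : IsBlockUpper k g.1) :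
    IsBlockUpper k (g⁻¹).1 := by
  have : Invertible g.1 := g.invertible
  have := Matrix.blockTriangular_inv_of_blockTriangular (isBlockUpper_iff.1 h)
  rw [Matrix.coe_units_inv]
  exact isBlockUpper_iff.2 this

theorem isBlockUpper_one {n : ℕ} {k : ℕ} : IsBlockUpper k (1 : Matrix (Fin n) (Fin n) ℝ) :=
  fun i j hi hj => Matrix.one_apply_ne (by rintro rfl; exact hi hj)

theorem IsBlockDiag.inv {n : ℕ} {k : ℕ} (g : GL (Fin n) ℝ) (h : IsBlockDiag k g.1) :
    IsBlockDiag k (g⁻¹).1 := by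
  obtain ⟨h1, h2⟩ := isBlockDiag_iff.1 h
  refine isBlockDiag_iff.2 ⟨h1.inv, ?_⟩
  let g' : GL (Fin n) ℝ := ⟨g.1ᵀ, (g⁻¹).1ᵀ, by
    rw [← Matrix.transpose_mul, Units.inv_mul, Matrix.transpose_one], by
    rw [← Matrix.transpose_mul, Units.mul_inv, Matrix.transpose_one]⟩
  exact IsBlockUpper.inv g' h2

/-- The subgroup `GL_k × GL_{n-k}` of `GL_n(ℝ)`: the invertible block diagonal matrices. -/
def blockGL (n k : ℕ) : Subgroup (GL (Fin n) ℝ) where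
  carrier := {g | IsBlockDiag k g.1}
  one_mem' := isBlockDiag_iff.2 ⟨isBlockUpper_one, by
    simpa using isBlockUpper_one⟩
  mul_mem' := by
    intro a b ha hb
    obtain ⟨a1, a2⟩ := isBlockDiag_iff.1 ha
    obtain ⟨b1, b2⟩ := isBlockDiag_iff.1 hb
    refine isBlockDiag_iff.2 ⟨a1.mul b1, ?_⟩
    rw [Units.val_mul, Matrix.transpose_mul]
    exact b2.mul a2
  inv_mem' := fun {g} h => IsBlockDiag.inv g h

/-- The subgroup `O_k × O_{n-k}` of `O_n`: the block diagonal orthogonal matrices. -/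
def blockO (n k : ℕ) : Subgroup (Matrix.orthogonalGroup (Fin n) ℝ) :=
  (blockGL n k).comap Unitary.toUnits

/-- The homogeneous space `GL_n(ℝ) / (GL_k × GL_{n-k})`, with the quotient topology. -/
abbrev GLQuot (n k : ℕ) : Type := GL (Fin n) ℝ ⧸ blockGL n k

/-- The homogeneous space `O_n / (O_k × O_{n-k})`, with the quotient topology. -/
abbrev OQuot (n k : ℕ) : Type := Matrix.orthogonalGroup (Fin n) ℝ ⧸ blockO n k

/-! ### The Gram-Schmidt map -/

/-- The columns of a matrix, as vectors of the Euclidean space. -/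
def colVec {n : ℕ} (W : Matrix (Fin n) (Fin n) ℝ) (j : Fin n) : EuclideanSpace ℝ (Fin n) :=
  WithLp.toLp 2 (fun i => W i j)

/-- The matrix obtained by applying the (normalised) Gram-Schmidt process to the columns. -/
noncomputable def gsMatrix {n : ℕ} (W : Matrix (Fin n) (Fin n) ℝ) : Matrix (Fin n) (Fin n) ℝ :=
  Matrix.of fun i j => InnerProductSpace.gramSchmidtNormed ℝ (colVec W) j i

theorem linearIndependent_colVec {n : ℕ} (W : GL (Fin n) ℝ) :
    LinearIndependent ℝ (colVec W.1) := by
  have h : LinearIndependent ℝ W.1.col :=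
    Matrix.linearIndependent_cols_of_isUnit W.isUnit
  exact h.map' (WithLp.linearEquiv 2 ℝ (Fin n → ℝ)).symm.toLinearMap
    (LinearEquiv.ker _)

theorem inner_eq_sum {n : ℕ} (x y : EuclideanSpace ℝ (Fin n)) :
    inner ℝ x y = ∑ i, x i * y i := by
  simp [PiLp.inner_apply, mul_comm]

theorem gsMatrix_mem {n : ℕ} (W : GL (Fin n) ℝ) :
    gsMatrix W.1 ∈ Matrix.orthogonalGroup (Fin n) ℝ := by
  rw [Matrix.mem_orthogonalGroup_iff']
  have h := InnerProductSpace.gramSchmidtNormed_orthonormal (linearIndependent_colVec W)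
  rw [orthonormal_iff_ite] at h
  ext i j
  rw [Matrix.one_apply, ← h i j, inner_eq_sum]
  rfl

/-- The Gram-Schmidt map `GL_n(ℝ) → O_n`, acting on the columns of matrices. -/
noncomputable def gramSchmidtGL {n : ℕ} (W : GL (Fin n) ℝ) : Matrix.orthogonalGroup (Fin n) ℝ :=
  ⟨gsMatrix W.1, gsMatrix_mem W⟩

theorem toUnits_val {n : ℕ} (V : Matrix.orthogonalGroup (Fin n) ℝ) :
    (Unitary.toUnits V).1 = V.1 := rfl

theorem toUnits_inv_val {n : ℕ} (V : Matrix.orthogonalGroup (Fin n) ℝ) :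
    ((Unitary.toUnits V)⁻¹).1 = V.1ᵀ := rfl

theorem orthogonal_isBlockDiag {n k : ℕ} (V : Matrix.orthogonalGroup (Fin n) ℝ)
    (h : IsBlockUpper k V.1) : V ∈ blockO n k := by
  refine isBlockDiag_iff.2 ⟨h, ?_⟩
  exact IsBlockUpper.inv (Unitary.toUnits V) h

/-- The triangular factor `Vᵀ W` of `W`, where `V` is the Gram-Schmidt matrix of `W`. -/
theorem isBlockUpper_gs {n : ℕ} (k : ℕ) (W : GL (Fin n) ℝ) :
    IsBlockUpper k ((Unitary.toUnits (gramSchmidtGL W))⁻¹ * W).1 := by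
  intro i j hi hj
  have h := InnerProductSpace.gramSchmidt_inv_triangular ℝ (colVec W.1)
    (i := j) (j := i) (by rw [Fin.lt_def]; omega)
  have h' : inner ℝ (InnerProductSpace.gramSchmidtNormed ℝ (colVec W.1) i) (colVec W.1 j) = 0 := by
    rw [InnerProductSpace.gramSchmidtNormed, inner_smul_left, h, mul_zero]
  rw [inner_eq_sum] at h'
  exact h'

theorem gs_wellDefined {n k : ℕ} (W W' : GL (Fin n) ℝ) (h : IsBlockUpper k (W⁻¹ * W').1) :
    (QuotientGroup.mk (gramSchmidtGL W) : OQuot n k) = QuotientGroup.mk (gramSchmidtGL W') := by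
  rw [QuotientGroup.eq]
  apply orthogonal_isBlockDiag
  have e : ((gramSchmidtGL W)⁻¹ * gramSchmidtGL W').1 =
      (((Unitary.toUnits (gramSchmidtGL W))⁻¹ * W) * (W⁻¹ * W') *
        ((Unitary.toUnits (gramSchmidtGL W'))⁻¹ * W')⁻¹).1 := by
    have : ((Unitary.toUnits (gramSchmidtGL W))⁻¹ * W) * (W⁻¹ * W') *
        ((Unitary.toUnits (gramSchmidtGL W'))⁻¹ * W')⁻¹ =
        Unitary.toUnits ((gramSchmidtGL W)⁻¹ * gramSchmidtGL W') := by
      rw [map_mul, map_inv]; group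
    rw [this]; rfl
  rw [e]
  exact ((isBlockUpper_gs k W).mul h).mul (IsBlockUpper.inv _ (isBlockUpper_gs k W'))

/-- The Gram-Schmidt map `υ : GL_n(ℝ) / (GL_k × GL_{n-k}) → O_n / (O_k × O_{n-k})`, induced by the
Gram-Schmidt map `GL_n(ℝ) → O_n`. -/
noncomputable def gramSchmidtMap (n k : ℕ) : GLQuot n k → OQuot n k :=
  Quotient.lift (fun W => (QuotientGroup.mk (gramSchmidtGL W) : OQuot n k)) (by
    intro W W' h
    have h' := QuotientGroup.leftRel_apply.1 h
    exact gs_wellDefined W W' (isBlockDiag_iff.1 h').1)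

/-! ### The idempotents -/

/-- The diagonal matrix `P_k` whose first `k` diagonal entries are `1`, the others being `0`. -/
def diagProj (n k : ℕ) : Matrix (Fin n) (Fin n) ℝ :=
  Matrix.diagonal fun i => if i.1 < k then 1 else 0

theorem diagProj_comm {n k : ℕ} {M : Matrix (Fin n) (Fin n) ℝ} (h : IsBlockDiag k M) :
    M * diagProj n k = diagProj n k * M := by
  ext i j
  rw [diagProj, Matrix.mul_diagonal, Matrix.diagonal_mul]
  by_cases hij : (i.1 < k ↔ j.1 < k)
  · simp [hij, mul_comm]
  · simp [h i j hij]

/-- The injection `[W] ↦ W P_k W⁻¹` of `GL_n(ℝ) / (GL_k × GL_{n-k})` into the set of idempotent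
matrices. -/
def idem (n k : ℕ) : GLQuot n k → Matrix (Fin n) (Fin n) ℝ :=
  Quotient.lift (fun W => W.1 * diagProj n k * (W⁻¹).1) (by
    intro W W' h
    have h' := diagProj_comm (QuotientGroup.leftRel_apply.1 h)
    have e : W'.1 = W.1 * (W⁻¹ * W').1 := by simp
    have e' : (W'⁻¹).1 = (W⁻¹ * W')⁻¹.1 * (W⁻¹).1 := by simp
    have e3 : W.1 * (W⁻¹ * W').1 * diagProj n k * ((W⁻¹ * W')⁻¹.1 * (W⁻¹).1) =
        W.1 * ((W⁻¹ * W').1 * diagProj n k) * ((W⁻¹ * W')⁻¹.1 * (W⁻¹).1) := by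
      simp only [Matrix.mul_assoc]
    show W.1 * diagProj n k * (W⁻¹).1 = W'.1 * diagProj n k * (W'⁻¹).1
    rw [e', e, e3, h']
    simp only [Matrix.mul_assoc]
    rw [← Matrix.mul_assoc (W⁻¹ * W').1, Units.mul_inv, Matrix.one_mul])

/-- The map `[V] ↦ V P_k Vᵀ` sending a point of `O_n / (O_k × O_{n-k})` to the orthogonal projection
onto the span of the first `k` columns of `V`. -/
def orthProj (n k : ℕ) : OQuot n k → Matrix (Fin n) (Fin n) ℝ :=
  Quotient.lift (fun V => V.1 * diagProj n k * V.1ᵀ) (by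
    intro V V' h
    have h' : (Unitary.toUnits V)⁻¹ * Unitary.toUnits V' ∈ blockGL n k := by
      have := QuotientGroup.leftRel_apply.1 h
      rw [← map_inv, ← map_mul]
      exact this
    have := congrArg (idem n k) (QuotientGroup.eq.2 h')
    exact this)

end GramSchmidtBundle

namespace GramSchmidtBundle

/-! ### The analytic structures of the homogeneous spaces -/

/-- The indices of the first block. -/
abbrev LowIdx (n k : ℕ) : Type := {i : Fin n // i.1 < k}

/-- The indices of the second block. -/
abbrev HighIdx (n k : ℕ) : Type := {i : Fin n // ¬ i.1 < k}

/-- The model space of `O_n / (O_k × O_{n-k})`: real `(n-k) × k` arrays. -/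
abbrev ModelO (n k : ℕ) : Type := HighIdx n k → LowIdx n k → ℝ

/-- The model space of `GL_n(ℝ) / (GL_k × GL_{n-k})`: pairs of an `(n-k) × k` array and a
`k × (n-k)` array. -/
abbrev ModelGL (n k : ℕ) : Type := ModelO n k × (LowIdx n k → HighIdx n k → ℝ)

/-- The upper left block. -/
def blkA {n : ℕ} (k : ℕ) (M : Matrix (Fin n) (Fin n) ℝ) : Matrix (LowIdx n k) (LowIdx n k) ℝ :=
  M.toBlock (fun i => i.1 < k) (fun i => i.1 < k)

/-- The upper right block. -/
def blkB {n : ℕ} (k : ℕ) (M : Matrix (Fin n) (Fin n) ℝ) : Matrix (LowIdx n k) (HighIdx n k) ℝ :=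
  M.toBlock (fun i => i.1 < k) (fun i => ¬ i.1 < k)

/-- The lower left block. -/
def blkC {n : ℕ} (k : ℕ) (M : Matrix (Fin n) (Fin n) ℝ) : Matrix (HighIdx n k) (LowIdx n k) ℝ :=
  M.toBlock (fun i => ¬ i.1 < k) (fun i => i.1 < k)

/-- The lower right block. -/
def blkD {n : ℕ} (k : ℕ) (M : Matrix (Fin n) (Fin n) ℝ) : Matrix (HighIdx n k) (HighIdx n k) ℝ :=
  M.toBlock (fun i => ¬ i.1 < k) (fun i => ¬ i.1 < k)

/-- `C A⁻¹`, for a matrix with blocks `A B` over `C D`. -/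
noncomputable def slopeLow {n : ℕ} (k : ℕ) (M : Matrix (Fin n) (Fin n) ℝ) : ModelO n k :=
  blkC k M * (blkA k M)⁻¹

/-- `B D⁻¹`, for a matrix with blocks `A B` over `C D`. -/
noncomputable def slopeHigh {n : ℕ} (k : ℕ) (M : Matrix (Fin n) (Fin n) ℝ) :
    LowIdx n k → HighIdx n k → ℝ :=
  blkB k M * (blkD k M)⁻¹

/-- The matrix with blocks `1 S` over `T 1`. -/
def glue {n k : ℕ} (p : ModelGL n k) : Matrix (Fin n) (Fin n) ℝ :=
  Matrix.of fun i j =>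
    if hi : i.1 < k then
      if hj : j.1 < k then if i = j then 1 else 0 else p.2 ⟨i, hi⟩ ⟨j, hj⟩
    else
      if hj : j.1 < k then p.1 ⟨i, hi⟩ ⟨j, hj⟩ else if i = j then 1 else 0

theorem blkA_glue {n k : ℕ} (p : ModelGL n k) : blkA k (glue p) = 1 := by
  ext ⟨i, hi⟩ ⟨j, hj⟩
  simp [blkA, glue, hi, hj, Matrix.one_apply]

theorem blkB_glue {n k : ℕ} (p : ModelGL n k) : blkB k (glue p) = p.2 := by
  ext ⟨i, hi⟩ ⟨j, hj⟩
  simp [blkB, glue, hi, hj]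

theorem blkC_glue {n k : ℕ} (p : ModelGL n k) : blkC k (glue p) = p.1 := by
  ext ⟨i, hi⟩ ⟨j, hj⟩
  simp [blkC, glue, hi, hj]

theorem blkD_glue {n k : ℕ} (p : ModelGL n k) : blkD k (glue p) = 1 := by
  ext ⟨i, hi⟩ ⟨j, hj⟩
  simp [blkD, glue, hi, hj, Matrix.one_apply]

theorem blk_ext {n k : ℕ} {M N : Matrix (Fin n) (Fin n) ℝ} (hA : blkA k M = blkA k N)
    (hB : blkB k M = blkB k N) (hC : blkC k M = blkC k N) (hD : blkD k M = blkD k N) : M = N := by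
  ext i j
  by_cases hi : i.1 < k <;> by_cases hj : j.1 < k
  · exact congrFun (congrFun hA ⟨i, hi⟩) ⟨j, hj⟩
  · exact congrFun (congrFun hB ⟨i, hi⟩) ⟨j, hj⟩
  · exact congrFun (congrFun hC ⟨i, hi⟩) ⟨j, hj⟩
  · exact congrFun (congrFun hD ⟨i, hi⟩) ⟨j, hj⟩

section mul

variable {n k : ℕ} (M N : Matrix (Fin n) (Fin n) ℝ)

theorem blkA_mul : blkA k (M * N) = blkA k M * blkA k N + blkB k M * blkC k N :=
  Matrix.toBlock_mul_eq_add _ _ _ _ _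

theorem blkB_mul : blkB k (M * N) = blkA k M * blkB k N + blkB k M * blkD k N :=
  Matrix.toBlock_mul_eq_add _ _ _ _ _

theorem blkC_mul : blkC k (M * N) = blkC k M * blkA k N + blkD k M * blkC k N :=
  Matrix.toBlock_mul_eq_add _ _ _ _ _

theorem blkD_mul : blkD k (M * N) = blkC k M * blkB k N + blkD k M * blkD k N :=
  Matrix.toBlock_mul_eq_add _ _ _ _ _

variable {N}

theorem isBlockUpper_iff_blkC : IsBlockUpper k N ↔ blkC k N = 0 := by
  constructor
  · intro h; ext ⟨i, hi⟩ ⟨j, hj⟩; exact h i j hi hj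
  · intro h i j hi hj; exact congrFun (congrFun h ⟨i, hi⟩) ⟨j, hj⟩

theorem isBlockUpper_transpose_iff_blkB : IsBlockUpper k Nᵀ ↔ blkB k N = 0 := by
  constructor
  · intro h; ext ⟨i, hi⟩ ⟨j, hj⟩; exact h j i hj hi
  · intro h i j hi hj; exact congrFun (congrFun h ⟨j, hj⟩) ⟨i, hi⟩

theorem det_of_isBlockUpper (h : IsBlockUpper k N) :
    N.det = (blkA k N).det * (blkD k N).det :=
  Matrix.twoBlockTriangular_det N (fun i : Fin n => i.1 < k) (fun i hi j hj => h i j hi hj)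

theorem blkA_mul_upper (h : IsBlockUpper k N) : blkA k (M * N) = blkA k M * blkA k N := by
  rw [blkA_mul, isBlockUpper_iff_blkC.1 h, Matrix.mul_zero, add_zero]

theorem blkC_mul_upper (h : IsBlockUpper k N) : blkC k (M * N) = blkC k M * blkA k N := by
  rw [blkC_mul, isBlockUpper_iff_blkC.1 h, Matrix.mul_zero, add_zero]

theorem blkB_mul_lower (h : IsBlockUpper k Nᵀ) : blkB k (M * N) = blkB k M * blkD k N := by
  rw [blkB_mul, isBlockUpper_transpose_iff_blkB.1 h, Matrix.mul_zero, zero_add]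

theorem blkD_mul_lower (h : IsBlockUpper k Nᵀ) : blkD k (M * N) = blkD k M * blkD k N := by
  rw [blkD_mul, isBlockUpper_transpose_iff_blkB.1 h, Matrix.mul_zero, zero_add]

end mul

theorem det_blk_ne_zero {n k : ℕ} (g : GL (Fin n) ℝ) (h : IsBlockUpper k g.1) :
    (blkA k g.1).det ≠ 0 ∧ (blkD k g.1).det ≠ 0 := by
  have h1 : g.1.det ≠ 0 := (Matrix.isUnit_iff_isUnit_det _).1 g.isUnit |>.ne_zero
  rw [det_of_isBlockUpper h] at h1
  exact ⟨left_ne_zero_of_mul h1, right_ne_zero_of_mul h1⟩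

theorem slope_cancel {l m : Type} [Fintype l] [DecidableEq l] [Fintype m]
    (C : Matrix m l ℝ) (A a : Matrix l l ℝ) (ha : a.det ≠ 0) :
    C * a * (A * a)⁻¹ = C * A⁻¹ := by
  rw [Matrix.mul_inv_rev, Matrix.mul_assoc, ← Matrix.mul_assoc a,
    Matrix.mul_nonsing_inv _ (isUnit_iff_ne_zero.2 ha), Matrix.one_mul]

/-- Right multiplication by an invertible block upper triangular matrix changes neither the slope
`C A⁻¹` nor the condition `det A ≠ 0`. -/
theorem low_mul {n k : ℕ} (M : Matrix (Fin n) (Fin n) ℝ) (g : GL (Fin n) ℝ)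
    (h : IsBlockUpper k g.1) : slopeLow k (M * g.1) = slopeLow k M ∧
      ((blkA k (M * g.1)).det ≠ 0 ↔ (blkA k M).det ≠ 0) := by
  have hd := (det_blk_ne_zero g h).1
  constructor
  · rw [slopeLow, blkA_mul_upper _ h, blkC_mul_upper _ h]
    exact slope_cancel _ _ _ hd
  · rw [blkA_mul_upper _ h, Matrix.det_mul]
    simp [hd]

theorem high_mul {n k : ℕ} (M : Matrix (Fin n) (Fin n) ℝ) (g : GL (Fin n) ℝ)
    (h : IsBlockDiag k g.1) : slopeHigh k (M * g.1) = slopeHigh k M ∧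
      ((blkD k (M * g.1)).det ≠ 0 ↔ (blkD k M).det ≠ 0) := by
  obtain ⟨h1, h2⟩ := isBlockDiag_iff.1 h
  have hd := (det_blk_ne_zero g h1).2
  constructor
  · rw [slopeHigh, blkD_mul_lower _ h2, blkB_mul_lower _ h2]
    exact slope_cancel _ _ _ hd
  · rw [blkD_mul_lower _ h2, Matrix.det_mul]
    simp [hd]

/-! #### Continuity and analyticity of the block operations -/

theorem continuous_blkA {n k : ℕ} : Continuous (blkA (n := n) k) :=
  continuous_id.matrix_submatrix _ _
theorem continuous_blkB {n k : ℕ} : Continuous (blkB (n := n) k) :=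
  continuous_id.matrix_submatrix _ _
theorem continuous_blkC {n k : ℕ} : Continuous (blkC (n := n) k) :=
  continuous_id.matrix_submatrix _ _
theorem continuous_blkD {n k : ℕ} : Continuous (blkD (n := n) k) :=
  continuous_id.matrix_submatrix _ _

theorem continuous_glue {n k : ℕ} : Continuous (glue (n := n) (k := k)) := by
  refine continuous_matrix fun i j => ?_
  simp only [glue, Matrix.of_apply]
  split_ifs <;> fun_prop

theorem continuousAt_slope {X l m : Type} [TopologicalSpace X] [Fintype l] [DecidableEq l]
    {C : X → Matrix m l ℝ} {A : X → Matrix l l ℝ} (hC : Continuous C) (hA : Continuous A)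
    {x : X} (hx : (A x).det ≠ 0) : ContinuousAt (fun x => C x * (A x)⁻¹) x := by
  have h : ContinuousAt (fun x => C x * ((A x).det⁻¹ • (A x).adjugate)) x := by
    have h2 : ContinuousAt (fun x => (A x).det⁻¹ • (A x).adjugate) x :=
      (hA.matrix_det.continuousAt.inv₀ hx).smul hA.matrix_adjugate.continuousAt
    have hm : Continuous fun q : Matrix m l ℝ × Matrix l l ℝ => q.1 * q.2 :=
      continuous_fst.matrix_mul continuous_snd
    exact hm.continuousAt.comp (hC.continuousAt.prodMk h2)
  simpa only [Matrix.inv_def, Ring.inverse_eq_inv'] using h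

theorem contDiffAt_det {E l : Type} [NormedAddCommGroup E] [NormedSpace ℝ E] [Fintype l]
    [DecidableEq l] {A : E → Matrix l l ℝ} {x : E}
    (hA : ∀ i j, ContDiffAt ℝ ω (fun x => A x i j) x) :
    ContDiffAt ℝ ω (fun x => (A x).det) x := by
  simp only [Matrix.det_apply]
  refine ContDiffAt.sum fun σ _ => ?_
  refine ContDiffAt.const_smul _ ?_
  exact contDiffAt_prod fun i _ => hA _ _

theorem contDiffAt_slope {E l m : Type} [NormedAddCommGroup E] [NormedSpace ℝ E] [Fintype l]
    [DecidableEq l] [Fintype m] {C : E → Matrix m l ℝ} {A : E → Matrix l l ℝ} {x : E}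
    (hC : ∀ i j, ContDiffAt ℝ ω (fun x => C x i j) x)
    (hA : ∀ i j, ContDiffAt ℝ ω (fun x => A x i j) x) (hx : (A x).det ≠ 0) :
    ContDiffAt ℝ ω (F := m → l → ℝ) (fun x => C x * (A x)⁻¹) x := by
  refine contDiffAt_pi.2 fun i => contDiffAt_pi.2 fun j => ?_
  simp only [Matrix.mul_apply, Matrix.inv_def, Ring.inverse_eq_inv', Matrix.smul_apply,
    smul_eq_mul, Matrix.adjugate_apply]
  refine ContDiffAt.sum fun a _ => (hC i a).mul ?_
  refine ((contDiffAt_det hA).inv hx).mul (contDiffAt_det fun b c => ?_)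
  by_cases hb : b = j
  · subst hb
    simp only [Matrix.updateRow_self]
    exact contDiffAt_const
  · simp only [Matrix.updateRow_ne hb]
    exact hA b c

theorem contDiffAt_slopeLow {E : Type} [NormedAddCommGroup E] [NormedSpace ℝ E] {n k : ℕ}
    {X : E → Matrix (Fin n) (Fin n) ℝ} {x : E}
    (hX : ∀ i j, ContDiffAt ℝ ω (fun x => X x i j) x) (hx : (blkA k (X x)).det ≠ 0) :
    ContDiffAt ℝ ω (fun x => slopeLow k (X x)) x :=
  contDiffAt_slope (C := fun x => blkC k (X x)) (A := fun x => blkA k (X x))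
    (fun i j => hX i.1 j.1) (fun i j => hX i.1 j.1) hx

theorem contDiffAt_slopeHigh {E : Type} [NormedAddCommGroup E] [NormedSpace ℝ E] {n k : ℕ}
    {X : E → Matrix (Fin n) (Fin n) ℝ} {x : E}
    (hX : ∀ i j, ContDiffAt ℝ ω (fun x => X x i j) x) (hx : (blkD k (X x)).det ≠ 0) :
    ContDiffAt ℝ ω (fun x => slopeHigh k (X x)) x :=
  contDiffAt_slope (C := fun x => blkB k (X x)) (A := fun x => blkD k (X x))
    (fun i j => hX i.1 j.1) (fun i j => hX i.1 j.1) hx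

theorem contDiff_mul_glue {n k : ℕ} (X : Matrix (Fin n) (Fin n) ℝ) (i j : Fin n) :
    ContDiff ℝ ω (fun p : ModelGL n k => (X * glue p) i j) := by
  simp only [Matrix.mul_apply]
  refine ContDiff.sum fun a _ => contDiff_const.mul ?_
  simp only [glue, Matrix.of_apply]
  split_ifs
  · exact contDiff_const
  · exact contDiff_const
  · exact (contDiff_apply_apply ℝ ℝ _ _).comp contDiff_snd
  · exact (contDiff_apply_apply ℝ ℝ _ _).comp contDiff_fst
  · exact contDiff_const
  · exact contDiff_const

/-! #### Charts of `GL_n(ℝ) / (GL_k × GL_{n-k})` -/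

/-- The coordinates `[W] ↦ (C A⁻¹, B D⁻¹)`, where `W` has blocks `A B` over `C D`. -/
noncomputable def coordGL (n k : ℕ) : GLQuot n k → ModelGL n k :=
  Quotient.lift (fun W => (slopeLow k W.1, slopeHigh k W.1)) (by
    intro W W' h
    have h' : IsBlockDiag k (W⁻¹ * W').1 := QuotientGroup.leftRel_apply.1 h
    have e : W'.1 = W.1 * (W⁻¹ * W').1 := by simp
    show (slopeLow k W.1, slopeHigh k W.1) = (slopeLow k W'.1, slopeHigh k W'.1)
    rw [e, (low_mul _ _ (isBlockDiag_iff.1 h').1).1, (high_mul _ _ h').1])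

/-- The domain of `coordGL`: the diagonal blocks `A` and `D` are invertible. -/
def domGL (n k : ℕ) : Set (GLQuot n k) :=
  {x | Quotient.lift (fun W : GL (Fin n) ℝ => (blkA k W.1).det ≠ 0 ∧ (blkD k W.1).det ≠ 0) (by
    intro W W' h
    have h' : IsBlockDiag k (W⁻¹ * W').1 := QuotientGroup.leftRel_apply.1 h
    have e : W'.1 = W.1 * (W⁻¹ * W').1 := by simp
    show ((blkA k W.1).det ≠ 0 ∧ (blkD k W.1).det ≠ 0) =
      ((blkA k W'.1).det ≠ 0 ∧ (blkD k W'.1).det ≠ 0)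
    rw [e, (low_mul _ _ (isBlockDiag_iff.1 h').1).2, (high_mul _ _ h').2]) x}

/-- An invertible matrix, as an element of `GL_n(ℝ)` (by convention `1` for singular matrices). -/
noncomputable def toGL {n : ℕ} (M : Matrix (Fin n) (Fin n) ℝ) : GL (Fin n) ℝ := by
  classical
  exact if h : M.det ≠ 0 then Matrix.GeneralLinearGroup.mkOfDetNeZero M h else 1

theorem toGL_val {n : ℕ} {M : Matrix (Fin n) (Fin n) ℝ} (h : M.det ≠ 0) : (toGL M).1 = M := by
  rw [toGL, dif_pos h]; rfl

theorem continuousOn_toGL {n : ℕ} :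
    ContinuousOn (toGL (n := n)) {M | M.det ≠ 0} := by
  rw [continuousOn_iff_continuous_domRestrict, Units.continuous_iff]
  constructor
  · have : Units.val ∘ ({M : Matrix (Fin n) (Fin n) ℝ | M.det ≠ 0}).domRestrict toGL =
        Subtype.val := by
      ext M : 1; exact toGL_val M.2
    rw [this]; exact continuous_subtype_val
  · have : (fun M => ((({M : Matrix (Fin n) (Fin n) ℝ | M.det ≠ 0}).domRestrict toGL M)⁻¹).1) =
        fun M => M.1.det⁻¹ • M.1.adjugate := by
      ext M : 1
      rw [Matrix.coe_units_inv, Set.domRestrict_apply, toGL_val M.2, Matrix.inv_def,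
        Ring.inverse_eq_inv']
    rw [this]
    exact (continuous_subtype_val.matrix_det.inv₀ fun M => M.2).smul
      continuous_subtype_val.matrix_adjugate

theorem exists_glue {n k : ℕ} (W : GL (Fin n) ℝ) (hA : (blkA k W.1).det ≠ 0)
    (hD : (blkD k W.1).det ≠ 0) :
    (glue (slopeLow k W.1, slopeHigh k W.1)).det ≠ 0 ∧
      (toGL (glue (slopeLow k W.1, slopeHigh k W.1)))⁻¹ * W ∈ blockGL n k := by
  let N : Matrix (Fin n) (Fin n) ℝ := Matrix.of fun i j => if (i.1 < k ↔ j.1 < k) then W.1 i j else 0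
  have nA : blkA k N = blkA k W.1 := by ext ⟨i, hi⟩ ⟨j, hj⟩; simp [blkA, N, hi, hj]
  have nB : blkB k N = 0 := by ext ⟨i, hi⟩ ⟨j, hj⟩; simp [blkB, N, hi, hj]
  have nC : blkC k N = 0 := by ext ⟨i, hi⟩ ⟨j, hj⟩; simp [blkC, N, hi, hj]
  have nD : blkD k N = blkD k W.1 := by ext ⟨i, hi⟩ ⟨j, hj⟩; simp [blkD, N, hi, hj]
  have hN : IsBlockDiag k N :=
    isBlockDiag_iff.2 ⟨isBlockUpper_iff_blkC.2 nC, isBlockUpper_transpose_iff_blkB.2 nB⟩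
  set p : ModelGL n k := (slopeLow k W.1, slopeHigh k W.1) with hp
  have hT : (show Matrix (HighIdx n k) (LowIdx n k) ℝ from p.1) * blkA k W.1 = blkC k W.1 := by
    show blkC k W.1 * (blkA k W.1)⁻¹ * blkA k W.1 = _
    rw [Matrix.mul_assoc, Matrix.nonsing_inv_mul _ (isUnit_iff_ne_zero.2 hA), Matrix.mul_one]
  have hS : (show Matrix (LowIdx n k) (HighIdx n k) ℝ from p.2) * blkD k W.1 = blkB k W.1 := by
    show blkB k W.1 * (blkD k W.1)⁻¹ * blkD k W.1 = _
    rw [Matrix.mul_assoc, Matrix.nonsing_inv_mul _ (isUnit_iff_ne_zero.2 hD), Matrix.mul_one]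
  have e : W.1 = glue p * N := by
    refine blk_ext (k := k) ?_ ?_ ?_ ?_
    · rw [blkA_mul, nA, nC, blkA_glue, Matrix.one_mul, Matrix.mul_zero, add_zero]
    · rw [blkB_mul, nB, nD, blkB_glue, Matrix.mul_zero, zero_add]; exact hS.symm
    · rw [blkC_mul, nA, nC, blkC_glue, Matrix.mul_zero, add_zero]; exact hT.symm
    · rw [blkD_mul, nB, nD, blkD_glue, Matrix.one_mul, Matrix.mul_zero, zero_add]
  have h1 : W.1.det ≠ 0 := ((Matrix.isUnit_iff_isUnit_det _).1 W.isUnit).ne_zero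
  have h2 : (glue p).det ≠ 0 := by
    rw [e, Matrix.det_mul] at h1
    exact left_ne_zero_of_mul h1
  refine ⟨h2, ?_⟩
  have e2 : ((toGL (glue p))⁻¹ * W).1 = N := by
    have h3 : W.1 = (toGL (glue p)).1 * N := by rw [toGL_val h2, ← e]
    rw [Units.val_mul, h3, ← Matrix.mul_assoc, Units.inv_mul, Matrix.one_mul]
  show IsBlockDiag k _
  rw [e2]
  exact hN

/-- The basic chart of `GL_n(ℝ) / (GL_k × GL_{n-k})`, around the class of the identity. Its inverse
sends `(T, S)` to the class of the matrix with blocks `1 S` over `T 1`. -/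
noncomputable def baseChartGL (n k : ℕ) : OpenPartialHomeomorph (GLQuot n k) (ModelGL n k) where
  toFun := coordGL n k
  invFun := fun p => QuotientGroup.mk (toGL (glue p))
  source := domGL n k
  target := {p | (glue p).det ≠ 0}
  map_source' := by
    intro x hx
    induction x using QuotientGroup.induction_on with
    | H W =>
    obtain ⟨hA, hD⟩ : (blkA k W.1).det ≠ 0 ∧ (blkD k W.1).det ≠ 0 := hx
    exact (exists_glue W hA hD).1
  map_target' := by
    intro p hp
    show (blkA k (toGL (glue p)).1).det ≠ 0 ∧ (blkD k (toGL (glue p)).1).det ≠ 0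
    rw [toGL_val hp, blkA_glue, blkD_glue]
    simp
  left_inv' := by
    intro x hx
    induction x using QuotientGroup.induction_on with
    | H W =>
    obtain ⟨hA, hD⟩ : (blkA k W.1).det ≠ 0 ∧ (blkD k W.1).det ≠ 0 := hx
    exact QuotientGroup.eq.2 (exists_glue W hA hD).2
  right_inv' := by
    intro p hp
    show (slopeLow k (toGL (glue p)).1, slopeHigh k (toGL (glue p)).1) = p
    rw [toGL_val hp, slopeLow, slopeHigh, blkA_glue, blkD_glue, blkB_glue, blkC_glue]
    simp only [inv_one]
    exact Prod.ext (Matrix.mul_one p.1) (Matrix.mul_one p.2)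
  open_source := by
    rw [← QuotientGroup.isOpenQuotientMap_mk.isQuotientMap.isOpen_preimage]
    exact ((continuous_blkA.comp Units.continuous_val).matrix_det.isOpen_preimage _
      isOpen_compl_singleton).inter ((continuous_blkD.comp Units.continuous_val).matrix_det.isOpen_preimage _
      isOpen_compl_singleton)
  open_target := continuous_glue.matrix_det.isOpen_preimage _ isOpen_compl_singleton
  continuousOn_toFun := by
    intro x hx
    refine ContinuousAt.continuousWithinAt ?_
    induction x using QuotientGroup.induction_on with
    | H W =>
    obtain ⟨hA, hD⟩ : (blkA k W.1).det ≠ 0 ∧ (blkD k W.1).det ≠ 0 := hx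
    rw [← QuotientGroup.isOpenQuotientMap_mk.continuousAt_comp_iff]
    exact (continuousAt_slope (continuous_blkC.comp Units.continuous_val)
      (continuous_blkA.comp Units.continuous_val) hA).prodMk
      (continuousAt_slope (continuous_blkB.comp Units.continuous_val)
      (continuous_blkD.comp Units.continuous_val) hD)
  continuousOn_invFun := by
    exact QuotientGroup.continuous_mk.comp_continuousOn
      (continuousOn_toGL.comp continuous_glue.continuousOn fun p hp => hp)

theorem inv_out_smul {G : Type} [Group G] {H : Subgroup G} (x : G ⧸ H) :
    (Quotient.out x)⁻¹ • x = (QuotientGroup.mk 1 : G ⧸ H) := by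
  rw [inv_smul_eq_iff]
  refine (QuotientGroup.out_eq' x).symm.trans ?_
  exact congrArg QuotientGroup.mk (mul_one (Quotient.out x)).symm

/-- The chart of `GL_n(ℝ) / (GL_k × GL_{n-k})` around `[W]`: the translate by `W` of the basic
chart. -/
noncomputable def chartGL {n k : ℕ} (W : GL (Fin n) ℝ) :
    OpenPartialHomeomorph (GLQuot n k) (ModelGL n k) :=
  (Homeomorph.smul W⁻¹).transOpenPartialHomeomorph (baseChartGL n k)

noncomputable instance chartedSpaceGLQuot (n k : ℕ) :
    ChartedSpace (ModelGL n k) (GLQuot n k) where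
  atlas := Set.range chartGL
  chartAt := fun x => chartGL (Quotient.out x)
  mem_chart_source := by
    intro x
    have h : (Quotient.out x)⁻¹ • x = (QuotientGroup.mk 1 : GLQuot n k) := inv_out_smul x
    show (Quotient.out x)⁻¹ • x ∈ domGL n k
    rw [h]
    show (blkA k 1).det ≠ 0 ∧ (blkD k 1).det ≠ 0
    simp only [blkA, blkD, Matrix.toBlock_one_self, Matrix.det_one]
    simp
  chart_mem_atlas := fun x => ⟨_, rfl⟩

instance isManifoldGLQuot (n k : ℕ) : IsManifold 𝓘(ℝ, ModelGL n k) ω (GLQuot n k) := by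
  refine isManifold_of_contDiffOn _ _ _ ?_
  rintro _ _ ⟨W, rfl⟩ ⟨W', rfl⟩
  have hsrc : ∀ p : ModelGL n k, p ∈ ((chartGL (k := k) W).symm ≫ₕ chartGL W').source →
      (glue p).det ≠ 0 ∧ (blkA k ((W'⁻¹ * W).1 * glue p)).det ≠ 0 ∧
        (blkD k ((W'⁻¹ * W).1 * glue p)).det ≠ 0 := by
    rintro p ⟨hp1, hp2⟩
    have h1 : (glue p).det ≠ 0 := hp1
    have h2 : (blkA k (W'⁻¹.1 * ((W⁻¹)⁻¹.1 * (toGL (glue p)).1))).det ≠ 0 ∧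
      (blkD k (W'⁻¹.1 * ((W⁻¹)⁻¹.1 * (toGL (glue p)).1))).det ≠ 0 := hp2
    rw [toGL_val h1, inv_inv, ← Matrix.mul_assoc, ← Units.val_mul] at h2
    exact ⟨h1, h2⟩
  have hfun : ∀ p : ModelGL n k, (glue p).det ≠ 0 →
      ((chartGL (k := k) W).symm ≫ₕ chartGL W') p =
        (slopeLow k ((W'⁻¹ * W).1 * glue p), slopeHigh k ((W'⁻¹ * W).1 * glue p)) := by
    intro p hp
    have h : ((chartGL (k := k) W).symm ≫ₕ chartGL W') p =
        (slopeLow k (W'⁻¹.1 * ((W⁻¹)⁻¹.1 * (toGL (glue p)).1)),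
          slopeHigh k (W'⁻¹.1 * ((W⁻¹)⁻¹.1 * (toGL (glue p)).1))) := rfl
    rw [h, toGL_val hp, inv_inv, ← Matrix.mul_assoc, ← Units.val_mul]
  have key : ContDiffOn ℝ ω ((chartGL (k := k) W).symm ≫ₕ chartGL W')
      ((chartGL (k := k) W).symm ≫ₕ chartGL W').source := by
    refine ContDiffOn.congr (f := fun p => (slopeLow k ((W'⁻¹ * W).1 * glue p),
      slopeHigh k ((W'⁻¹ * W).1 * glue p))) (fun p hp => ?_) fun p hp => hfun p (hsrc p hp).1
    have hX : ∀ i j, ContDiffAt ℝ ω (fun p : ModelGL n k => ((W'⁻¹ * W).1 * glue p) i j) p :=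
      fun i j => (contDiff_mul_glue _ i j).contDiffAt
    exact (ContDiffAt.prodMk (contDiffAt_slopeLow hX (hsrc p hp).2.1)
      (contDiffAt_slopeHigh hX (hsrc p hp).2.2)).contDiffWithinAt
  simpa using key

/-! #### Charts of `O_n / (O_k × O_{n-k})` -/

/-- The coordinates `[V] ↦ C A⁻¹`, where `V` has blocks `A B` over `C D`. -/
noncomputable def coordO (n k : ℕ) : OQuot n k → ModelO n k :=
  Quotient.lift (fun V => slopeLow k V.1) (by
    intro V V' h
    have h' : IsBlockDiag k (V⁻¹ * V').1 := QuotientGroup.leftRel_apply.1 h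
    have e : V'.1 = V.1 * (Unitary.toUnits (V⁻¹ * V')).1 := by
      rw [toUnits_val]; exact congrArg Subtype.val (mul_inv_cancel_left V V').symm
    show slopeLow k V.1 = slopeLow k V'.1
    rw [e, (low_mul _ _ (isBlockDiag_iff.1 h').1).1])

/-- The domain of `coordO`: the block `A` is invertible. -/
def domO (n k : ℕ) : Set (OQuot n k) :=
  {x | Quotient.lift (fun V : Matrix.orthogonalGroup (Fin n) ℝ => (blkA k V.1).det ≠ 0) (by
    intro V V' h
    have h' : IsBlockDiag k (V⁻¹ * V').1 := QuotientGroup.leftRel_apply.1 h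
    have e : V'.1 = V.1 * (Unitary.toUnits (V⁻¹ * V')).1 := by
      rw [toUnits_val]; exact congrArg Subtype.val (mul_inv_cancel_left V V').symm
    show ((blkA k V.1).det ≠ 0) = ((blkA k V'.1).det ≠ 0)
    rw [e, (low_mul _ _ (isBlockDiag_iff.1 h').1).2]) x}

theorem det_glue_zero {n k : ℕ} (T : ModelO n k) : (glue (T, 0)).det ≠ 0 := by
  have h : IsBlockUpper k (glue (T, 0))ᵀ :=
    isBlockUpper_transpose_iff_blkB.2 (blkB_glue (T, 0))
  have hA : blkA k (glue (T, 0))ᵀ = 1 :=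
    (congrArg Matrix.transpose (blkA_glue (T, 0))).trans Matrix.transpose_one
  have hD : blkD k (glue (T, 0))ᵀ = 1 :=
    (congrArg Matrix.transpose (blkD_glue (T, 0))).trans Matrix.transpose_one
  rw [← Matrix.det_transpose, det_of_isBlockUpper h, hA, hD]
  simp

theorem mk_gs_toUnits {n k : ℕ} (V : Matrix.orthogonalGroup (Fin n) ℝ) :
    (QuotientGroup.mk (gramSchmidtGL (Unitary.toUnits V)) : OQuot n k) = QuotientGroup.mk V := by
  rw [QuotientGroup.eq]
  apply orthogonal_isBlockDiag
  have h := isBlockUpper_gs k (Unitary.toUnits V)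
  rwa [← map_inv, ← map_mul, toUnits_val] at h

theorem gs_eq {n : ℕ} (W : GL (Fin n) ℝ) : (gramSchmidtGL W).1 =
    W.1 * (((Unitary.toUnits (gramSchmidtGL W))⁻¹ * W)⁻¹).1 := by
  rw [← Units.val_mul, mul_inv_rev, inv_inv, mul_inv_cancel_left, toUnits_val]

theorem continuous_gramSchmidtGL {n : ℕ} :
    Continuous (gramSchmidtGL : GL (Fin n) ℝ → Matrix.orthogonalGroup (Fin n) ℝ) := by
  have hcol : ∀ j : Fin n, Continuous fun W : GL (Fin n) ℝ => colVec W.1 j := fun j =>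
    (PiLp.continuous_toLp 2 _).comp
      (continuous_pi fun i => Units.continuous_val.matrix_elem i j)
  have hgs : ∀ j : Fin n, Continuous fun W : GL (Fin n) ℝ =>
      InnerProductSpace.gramSchmidt ℝ (colVec W.1) j := by
    intro j
    induction j using WellFoundedLT.induction with
    | ind j ih =>
    have e : (fun W : GL (Fin n) ℝ => InnerProductSpace.gramSchmidt ℝ (colVec W.1) j) = fun W =>
        colVec W.1 j - ∑ i ∈ Finset.Iio j,
          (ℝ ∙ InnerProductSpace.gramSchmidt ℝ (colVec W.1) i).starProjection (colVec W.1 j) :=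
      funext fun W => InnerProductSpace.gramSchmidt_def ℝ _ j
    rw [e]
    simp only [Submodule.starProjection_singleton]
    refine (hcol j).sub (continuous_finsetSum _ fun i hi => ?_)
    have hi' := ih i (Finset.mem_Iio.1 hi)
    refine (((Continuous.inner (𝕜 := ℝ) hi' (hcol j)).div ?_) ?_).smul hi'
    · exact RCLike.continuous_ofReal.comp (hi'.norm.pow 2)
    · intro W
      have := InnerProductSpace.gramSchmidt_ne_zero i (linearIndependent_colVec W)
      simpa using this
  refine Continuous.subtype_mk (continuous_matrix fun i j => ?_) _
  have h : Continuous fun W : GL (Fin n) ℝ =>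
      InnerProductSpace.gramSchmidtNormed ℝ (colVec W.1) j := by
    simp only [InnerProductSpace.gramSchmidtNormed]
    refine Continuous.fun_smul (Continuous.inv₀ (f := fun W : GL (Fin n) ℝ =>
      (RCLike.ofReal ‖InnerProductSpace.gramSchmidt ℝ (colVec W.1) j‖ : ℝ)) ?_ ?_) (hgs j)
    · exact RCLike.continuous_ofReal.comp (hgs j).norm
    · intro W
      have := InnerProductSpace.gramSchmidt_ne_zero j (linearIndependent_colVec W)
      simpa using this
  exact (EuclideanSpace.proj (𝕜 := ℝ) i).continuous.comp h

/-- The basic chart of `O_n / (O_k × O_{n-k})`, around the class of the identity. Its inverse sends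
`T` to the class of the Gram-Schmidt matrix of the matrix with blocks `1 0` over `T 1`. -/
noncomputable def baseChartO (n k : ℕ) : OpenPartialHomeomorph (OQuot n k) (ModelO n k) where
  toFun := coordO n k
  invFun := fun T => QuotientGroup.mk (gramSchmidtGL (toGL (glue (T, 0))))
  source := domO n k
  target := Set.univ
  map_source' := fun _ _ => Set.mem_univ _
  map_target' := by
    intro T _
    show (blkA k (gramSchmidtGL (toGL (glue (T, 0)))).1).det ≠ 0
    rw [gs_eq, (low_mul _ _ (IsBlockUpper.inv _ (isBlockUpper_gs k _))).2,
      toGL_val (det_glue_zero T), blkA_glue]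
    simp
  left_inv' := by
    intro x hx
    induction x using QuotientGroup.induction_on with
    | H V =>
    have hA : (blkA k V.1).det ≠ 0 := hx
    rw [← mk_gs_toUnits V]
    apply gs_wellDefined
    rw [mk_gs_toUnits V]
    show IsBlockUpper k ((toGL (glue (slopeLow k V.1, 0)))⁻¹ * Unitary.toUnits V).1
    set g := toGL (glue (slopeLow k V.1, 0)) with hg
    set N := g⁻¹ * Unitary.toUnits V with hN
    have e : V.1 = glue (slopeLow k V.1, 0) * N.1 := by
      rw [← toGL_val (det_glue_zero (slopeLow k V.1)), ← hg, ← Units.val_mul, hN,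
        mul_inv_cancel_left, toUnits_val]
    have eA : blkA k V.1 = blkA k N.1 := by
      conv_lhs => rw [e]
      rw [blkA_mul, blkA_glue, blkB_glue]
      exact (congrArg₂ _ (Matrix.one_mul _) (Matrix.zero_mul _)).trans (add_zero _)
    have eC : blkC k V.1 = blkC k V.1 * (blkA k V.1)⁻¹ * blkA k N.1 + blkC k N.1 := by
      conv_lhs => rw [e]
      rw [blkC_mul, blkC_glue, blkD_glue, Matrix.one_mul]
      rfl
    rw [← eA, Matrix.mul_assoc, Matrix.nonsing_inv_mul _ (isUnit_iff_ne_zero.2 hA),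
      Matrix.mul_one] at eC
    exact isBlockUpper_iff_blkC.2 (left_eq_add.1 eC)
  right_inv' := by
    intro T _
    show slopeLow k (gramSchmidtGL (toGL (glue (T, 0)))).1 = T
    rw [gs_eq, (low_mul _ _ (IsBlockUpper.inv _ (isBlockUpper_gs k _))).1,
      toGL_val (det_glue_zero T), slopeLow, blkA_glue, blkC_glue, inv_one]
    exact Matrix.mul_one _
  open_source := by
    rw [← QuotientGroup.isOpenQuotientMap_mk.isQuotientMap.isOpen_preimage]
    exact (continuous_blkA.comp continuous_subtype_val).matrix_det.isOpen_preimage _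
      isOpen_compl_singleton
  open_target := isOpen_univ
  continuousOn_toFun := by
    intro x hx
    refine ContinuousAt.continuousWithinAt ?_
    induction x using QuotientGroup.induction_on with
    | H V =>
    have hA : (blkA k V.1).det ≠ 0 := hx
    rw [← QuotientGroup.isOpenQuotientMap_mk.continuousAt_comp_iff]
    exact continuousAt_slope (continuous_blkC.comp continuous_subtype_val)
      (continuous_blkA.comp continuous_subtype_val) hA
  continuousOn_invFun := by
    refine (QuotientGroup.continuous_mk.comp continuous_gramSchmidtGL).comp_continuousOn ?_
    refine continuousOn_toGL.comp (t := {M : Matrix (Fin n) (Fin n) ℝ | M.det ≠ 0}) ?_ fun T _ => det_glue_zero T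
    exact (continuous_glue.comp (Continuous.prodMk_left 0)).continuousOn

/-- The chart of `O_n / (O_k × O_{n-k})` around `[V]`: the translate by `V` of the basic chart. -/
noncomputable def chartO {n k : ℕ} (V : Matrix.orthogonalGroup (Fin n) ℝ) :
    OpenPartialHomeomorph (OQuot n k) (ModelO n k) :=
  (Homeomorph.smul V⁻¹).transOpenPartialHomeomorph (baseChartO n k)

noncomputable instance chartedSpaceOQuot (n k : ℕ) :
    ChartedSpace (ModelO n k) (OQuot n k) where
  atlas := Set.range chartO
  chartAt := fun x => chartO (Quotient.out x)
  mem_chart_source := by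
    intro x
    have h : (Quotient.out x)⁻¹ • x = (QuotientGroup.mk 1 : OQuot n k) := inv_out_smul x
    show (Quotient.out x)⁻¹ • x ∈ domO n k
    rw [h]
    show (blkA k 1).det ≠ 0
    simp only [blkA, Matrix.toBlock_one_self, Matrix.det_one]
    simp
  chart_mem_atlas := fun x => ⟨_, rfl⟩

instance isManifoldOQuot (n k : ℕ) : IsManifold 𝓘(ℝ, ModelO n k) ω (OQuot n k) := by
  refine isManifold_of_contDiffOn _ _ _ ?_
  rintro _ _ ⟨V, rfl⟩ ⟨V', rfl⟩
  have hval : ∀ T : ModelO n k, ∃ g : GL (Fin n) ℝ, IsBlockUpper k g.1 ∧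
      (V'⁻¹ * ((V⁻¹)⁻¹ * gramSchmidtGL (toGL (glue (T, 0))))).1 =
        (V'⁻¹ * V).1 * glue (T, 0) * g.1 := by
    intro T
    refine ⟨_, IsBlockUpper.inv _ (isBlockUpper_gs k (toGL (glue (T, 0)))), ?_⟩
    rw [inv_inv, ← mul_assoc]
    show (V'⁻¹ * V).1 * (gramSchmidtGL (toGL (glue (T, 0)))).1 = _
    rw [gs_eq, toGL_val (det_glue_zero T), Matrix.mul_assoc]
  have hsrc : ∀ T : ModelO n k, T ∈ ((chartO (k := k) V).symm ≫ₕ chartO V').source →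
      (blkA k ((V'⁻¹ * V).1 * glue (T, 0))).det ≠ 0 := by
    rintro T ⟨-, hT⟩
    have h : (blkA k (V'⁻¹ * ((V⁻¹)⁻¹ * gramSchmidtGL (toGL (glue (T, 0))))).1).det ≠ 0 := hT
    obtain ⟨g, hg, e⟩ := hval T
    rwa [e, (low_mul _ g hg).2] at h
  have hfun : ∀ T : ModelO n k, ((chartO (k := k) V).symm ≫ₕ chartO V') T =
      slopeLow k ((V'⁻¹ * V).1 * glue (T, 0)) := by
    intro T
    have h : ((chartO (k := k) V).symm ≫ₕ chartO V') T =
        slopeLow k (V'⁻¹ * ((V⁻¹)⁻¹ * gramSchmidtGL (toGL (glue (T, 0))))).1 := rfl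
    obtain ⟨g, hg, e⟩ := hval T
    rw [h, e, (low_mul _ g hg).1]
  have key : ContDiffOn ℝ ω ((chartO (k := k) V).symm ≫ₕ chartO V')
      ((chartO (k := k) V).symm ≫ₕ chartO V').source := by
    refine ContDiffOn.congr (f := fun T => slopeLow k ((V'⁻¹ * V).1 * glue (T, 0)))
      (fun T hT => ?_) fun T _ => hfun T
    have hX : ∀ i j, ContDiffAt ℝ ω
        (fun T : ModelO n k => ((V'⁻¹ * V).1 * glue (T, 0)) i j) T := fun i j =>
      ((contDiff_mul_glue _ i j).comp (contDiff_id.prodMk contDiff_const)).contDiffAt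
    exact (contDiffAt_slopeLow hX (hsrc T hT)).contDiffWithinAt
  simpa using key

end GramSchmidtBundle

namespace GramSchmidtBundle

/-! ### Analytic quotient maps and analytic vector bundles -/

/-- `π : S → X`, defined on an analytic submanifold `j : S → ℝ^{n×n}` of the space of matrices, is an
analytic submersion: locally it is the restriction of an analytic map on an open set of matrices,
and through every point of `S` there passes an analytic local section of `π`. For a surjective `π`
this determines the analytic structure of `X`. -/
def IsAnalyticSubmersion {n : ℕ} {S X E : Type} [TopologicalSpace S] [TopologicalSpace X]
    [NormedAddCommGroup E] [NormedSpace ℝ E] [ChartedSpace E X]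
    (j : S → Fin n → Fin n → ℝ) (π : S → X) : Prop :=
  ∀ s : S,
    (∃ f : (Fin n → Fin n → ℝ) → X,
      ContMDiffAt 𝓘(ℝ, Fin n → Fin n → ℝ) 𝓘(ℝ, E) ω f (j s) ∧ ∀ᶠ t in 𝓝 s, f (j t) = π t) ∧
    ∃ τ : X → S, τ (π s) = s ∧
      ContMDiffAt 𝓘(ℝ, E) 𝓘(ℝ, Fin n → Fin n → ℝ) ω (fun y => j (τ y)) (π s) ∧
      ∀ᶠ y in 𝓝 (π s), π (τ y) = y

/-- The surjection `proj : Z → B` between analytic manifolds, with the given vector space structures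
on its fibres, is a locally trivial real analytic vector bundle with model fibre `F`: there are
fibrewise linear, bi-analytic local trivialisations around all points of `B`, whose transition
functions are analytic as maps into the continuous linear operators of `F`. -/
structure IsAnalyticVectorBundle (F : Type) [NormedAddCommGroup F] [NormedSpace ℝ F]
    {EB HB B EZ HZ Z : Type} [NormedAddCommGroup EB] [NormedSpace ℝ EB] [TopologicalSpace HB]
    (IB : ModelWithCorners ℝ EB HB) [TopologicalSpace B] [ChartedSpace HB B]
    [NormedAddCommGroup EZ] [NormedSpace ℝ EZ] [TopologicalSpace HZ]
    (IZ : ModelWithCorners ℝ EZ HZ) [TopologicalSpace Z] [ChartedSpace HZ Z]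
    (proj : Z → B) [∀ b : B, AddCommGroup (proj ⁻¹' {b})] [∀ b : B, Module ℝ (proj ⁻¹' {b})] :
    Prop where
  isManifold_base : IsManifold IB ω B
  isManifold_total : IsManifold IZ ω Z
  t2_base : T2Space B
  t2_total : T2Space Z
  surjective : Function.Surjective proj
  analytic_proj : ContMDiff IZ IB ω proj
  exists_trivializations : ∃ e : B → Bundle.Trivialization F proj,
    (∀ b : B, b ∈ (e b).baseSet ∧
      ContMDiffOn IZ (IB.prod 𝓘(ℝ, F)) ω (e b) (e b).source ∧
      ContMDiffOn (IB.prod 𝓘(ℝ, F)) IZ ω (e b).toOpenPartialHomeomorph.symm (e b).target ∧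
      ∀ x ∈ (e b).baseSet, IsLinearMap ℝ fun z : proj ⁻¹' {x} => (e b z.1).2) ∧
    ∀ b b' : B, ∃ φ : B → F →L[ℝ] F,
      ContMDiffOn IB 𝓘(ℝ, F →L[ℝ] F) ω φ ((e b).baseSet ∩ (e b').baseSet) ∧
      ∀ x ∈ (e b).baseSet ∩ (e b').baseSet, ∀ v : F, φ x v = (e b).coordChange (e b') x v

end GramSchmidtBundle

open GramSchmidtBundle

namespace GramSchmidtBundle

/-! ### Algebra of the idempotents -/

section algebra

variable {n k : ℕ}

/-! Write `P` for `diagProj n k`. A point `y = [W]` is the idempotent `Q = W P W⁻¹`, that is, a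
splitting of `ℝⁿ` into a `k`-dimensional range and a complementary kernel; a point `x = [V]` is the
orthogonal projection `R = V P Vᵀ`, that is, a `k`-dimensional subspace. Since `Q Q' = Q'` holds
exactly when `W⁻¹ W'` is block upper triangular (`idem_mul_idem_iff`), and the Gram-Schmidt process
only multiplies on the right by such matrices, `υ` forgets the kernel and keeps the range: `υ y = x`
if and only if `R Q = Q` (`gramSchmidtMap_eq_iff`). The fibre over `x` is therefore the set of all
`R + N` with `R N = N` and `N R = 0`, and every such `N` occurs because `R + N` is the conjugate of
`R` by `1 - N` (`exists_of_mem_fibreSpace`).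

Analyticity is tested on matrices. The idempotent depends analytically on the point, and near a
given point the chart is a rational function of the idempotent. Hence a map into either homogeneous
space is analytic as soon as its composite with `idem` or `orthProj` has analytic entries
(`contMDiffAt_of_idem`, `contMDiffAt_of_orthProj`). The analyticity of `υ` then reduces to that of
the Gram-Schmidt process on invertible matrices.

Put `L = range R`. The tangent space of the Grassmannian at `L` is `Hom(L, L^⊥)`, whereas the
matrices `N` above form `Hom(L^⊥, L)`; transposition exchanges the two. In the chart centred at
`[V]`, the tangent vector `v` goes to `N = V U Vᵀ`, where `U` has upper right block `vᵀ` and is zero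
elsewhere (`modelEquiv`). The heart of the matter is that this does not depend on the chart in an
essential way (`conj_modelEquiv`): if `w` represents the same tangent vector in the chart at `[V₀]`
and `R' = V₀ᵀ R V₀`, then `V₀ᵀ N V₀ = R' U(w) (1 - R')`. This is where the orthogonality of the
representatives enters, as it turns the derivative of the fractional linear chart change into `v =
Dᵀ w A`. The formula is analytic in `R` and `w`, and can be solved for `w`, so the fibrewise linear
bijection `Φ` from `TX` to `Y` is bi-analytic. The bundle structure of `υ` is then that of `TX`,
carried over by `Φ`. -/

theorem diagProj_mul_self : diagProj n k * diagProj n k = diagProj n k := by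
  rw [diagProj, Matrix.diagonal_mul_diagonal]
  congr 1
  ext i
  split_ifs <;> simp

theorem blkA_diagProj : blkA k (diagProj n k) = 1 := by
  ext ⟨i, hi⟩ ⟨j, hj⟩
  simp [blkA, diagProj, Matrix.diagonal_apply, hi, Matrix.one_apply]

theorem blkB_diagProj : blkB k (diagProj n k) = 0 := by
  ext ⟨i, hi⟩ ⟨j, hj⟩
  have : i ≠ j := by rintro rfl; exact hj hi
  simp [blkB, diagProj, this]

theorem blkC_diagProj : blkC k (diagProj n k) = 0 := by
  ext ⟨i, hi⟩ ⟨j, hj⟩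
  have : i ≠ j := by rintro rfl; exact hi hj
  simp [blkC, diagProj, this]

theorem blkD_diagProj : blkD k (diagProj n k) = 0 := by
  ext ⟨i, hi⟩ ⟨j, hj⟩
  simp [blkD, diagProj, Matrix.diagonal_apply, hi]

/-- Both say that `N` preserves the range of `P`. In this form the condition can be conjugated into
a relation between idempotents. -/
theorem isBlockUpper_iff_diagProj {N : Matrix (Fin n) (Fin n) ℝ} :
    IsBlockUpper k N ↔ diagProj n k * (N * diagProj n k) = N * diagProj n k := by
  constructor
  · intro h
    ext i j
    rw [diagProj, Matrix.diagonal_mul, Matrix.mul_diagonal]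
    by_cases hi : i.1 < k <;> by_cases hj : j.1 < k <;> simp [hi, hj]
    exact (h i j hi hj).symm
  · intro h i j hi hj
    have := congrFun (congrFun h i) j
    rw [diagProj, Matrix.diagonal_mul, Matrix.mul_diagonal] at this
    simpa [hi, hj, eq_comm] using this

theorem isBlockDiag_iff_diagProj {N : Matrix (Fin n) (Fin n) ℝ} :
    IsBlockDiag k N ↔ N * diagProj n k = diagProj n k * N := by
  refine ⟨diagProj_comm, fun h i j hij => ?_⟩
  have := congrFun (congrFun h i) j
  rw [diagProj, Matrix.diagonal_mul, Matrix.mul_diagonal] at this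
  by_cases hi : i.1 < k <;> by_cases hj : j.1 < k <;> simp_all

theorem idem_mk (W : GL (Fin n) ℝ) :
    idem n k (QuotientGroup.mk W) = W.1 * diagProj n k * (W⁻¹).1 := rfl

theorem orthProj_mk (V : Matrix.orthogonalGroup (Fin n) ℝ) :
    orthProj n k (QuotientGroup.mk V) = V.1 * diagProj n k * V.1ᵀ := rfl

theorem gramSchmidtMap_mk (W : GL (Fin n) ℝ) :
    gramSchmidtMap n k (QuotientGroup.mk W) = QuotientGroup.mk (gramSchmidtGL W) := rfl

theorem orthProj_mk_eq_idem (V : Matrix.orthogonalGroup (Fin n) ℝ) :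
    orthProj n k (QuotientGroup.mk V) = idem n k (QuotientGroup.mk (Unitary.toUnits V)) := rfl

theorem transpose_mul_orthogonal (V : Matrix.orthogonalGroup (Fin n) ℝ) : V.1ᵀ * V.1 = 1 :=
  (Matrix.mem_orthogonalGroup_iff' _ _).1 V.2

theorem orthogonal_mul_transpose (V : Matrix.orthogonalGroup (Fin n) ℝ) : V.1 * V.1ᵀ = 1 :=
  (Matrix.mem_orthogonalGroup_iff _ _).1 V.2

/-- Conjugation turns the equation `P N P = N P` into `Q Q' = Q'`. -/
theorem idem_mul_idem_iff (W W' : GL (Fin n) ℝ) :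
    idem n k (QuotientGroup.mk W) * idem n k (QuotientGroup.mk W') =
      idem n k (QuotientGroup.mk W') ↔ IsBlockUpper k (W⁻¹ * W').1 := by
  rw [isBlockUpper_iff_diagProj, idem_mk, idem_mk, Units.val_mul]
  constructor
  · intro h
    have := congrArg (fun X => (W⁻¹).1 * X * W'.1) h
    simpa [Matrix.mul_assoc] using this
  · intro h
    have := congrArg (fun X => W.1 * X * (W'⁻¹).1) h
    simpa [Matrix.mul_assoc] using this

/-- The stabiliser of `P` under conjugation is its centraliser, which is the block diagonal group.
-/
theorem idem_injective : Function.Injective (idem n k) := by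
  intro x y h
  induction x using QuotientGroup.induction_on with
  | H W =>
  induction y using QuotientGroup.induction_on with
  | H W' =>
  refine QuotientGroup.eq.2 ?_
  show IsBlockDiag k (W⁻¹ * W').1
  rw [isBlockDiag_iff_diagProj]
  have := congrArg (fun X => (W⁻¹).1 * X * W'.1) h
  simpa [Matrix.mul_assoc, idem_mk] using this.symm

/-- By the QR decomposition, `W` and its Gram-Schmidt matrix differ by a block upper triangular
factor on the right. Conversely, by `gs_wellDefined` the class of the Gram-Schmidt matrix depends
only on `W` modulo such factors, and `V` represents its own class. -/
theorem gramSchmidtMap_mk_eq_iff (W : GL (Fin n) ℝ) (V : Matrix.orthogonalGroup (Fin n) ℝ) :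
    gramSchmidtMap n k (QuotientGroup.mk W) = QuotientGroup.mk V ↔
      IsBlockUpper k ((Unitary.toUnits V)⁻¹ * W).1 := by
  constructor
  · intro h
    have h1 : V⁻¹ * gramSchmidtGL W ∈ blockO n k := QuotientGroup.eq.1 h.symm
    have h2 : IsBlockUpper k ((Unitary.toUnits V)⁻¹ * Unitary.toUnits (gramSchmidtGL W)).1 := by
      rw [← map_inv, ← map_mul]
      exact (isBlockDiag_iff.1 h1).1
    have h3 := h2.mul (isBlockUpper_gs k W)
    rwa [← Units.val_mul, mul_assoc, mul_inv_cancel_left] at h3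
  · intro h
    rw [gramSchmidtMap_mk, eq_comm, ← mk_gs_toUnits V]
    exact gs_wellDefined _ _ h

theorem gramSchmidtMap_eq_iff (x : OQuot n k) (y : GLQuot n k) :
    gramSchmidtMap n k y = x ↔ orthProj n k x * idem n k y = idem n k y := by
  induction x using QuotientGroup.induction_on with
  | H V =>
  induction y using QuotientGroup.induction_on with
  | H W =>
  rw [gramSchmidtMap_mk_eq_iff, orthProj_mk_eq_idem, idem_mul_idem_iff]

/-- The reverse inclusion of the ranges. No dimension count is needed: the inverse of a block upper
triangular matrix is again block upper triangular. -/
theorem idem_mul_orthProj (x : OQuot n k) (y : GLQuot n k) (h : gramSchmidtMap n k y = x) :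
    idem n k y * orthProj n k x = orthProj n k x := by
  induction x using QuotientGroup.induction_on with
  | H V =>
  induction y using QuotientGroup.induction_on with
  | H W =>
  rw [orthProj_mk_eq_idem, idem_mul_idem_iff]
  have := IsBlockUpper.inv _ ((gramSchmidtMap_mk_eq_iff _ _).1 h)
  rwa [mul_inv_rev, inv_inv] at this

theorem idem_mul_self (y : GLQuot n k) : idem n k y * idem n k y = idem n k y := by
  induction y using QuotientGroup.induction_on with
  | H W =>
  rw [idem_mul_idem_iff, inv_mul_cancel]
  exact isBlockUpper_one

theorem orthProj_mul_self (x : OQuot n k) :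
    orthProj n k x * orthProj n k x = orthProj n k x := by
  induction x using QuotientGroup.induction_on with
  | H V => exact idem_mul_self (QuotientGroup.mk (Unitary.toUnits V))

/-- The inclusion of orthogonal into invertible matrices induces a section of `υ`, and `orthProj` is
`idem` after this section. -/
theorem orthProj_injective : Function.Injective (orthProj n k) := by
  intro x y h
  induction x using QuotientGroup.induction_on with
  | H V =>
  induction y using QuotientGroup.induction_on with
  | H V' =>
  rw [orthProj_mk_eq_idem, orthProj_mk_eq_idem] at h
  have := congrArg (gramSchmidtMap n k) (idem_injective h)
  rwa [gramSchmidtMap_mk, gramSchmidtMap_mk, mk_gs_toUnits, mk_gs_toUnits] at this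

/-- The linear space of the differences `Q - R`, for an orthogonal projection `R` and the
idempotents `Q` with the same range. -/
def fibreSpace (n k : ℕ) (x : OQuot n k) : Submodule ℝ (Matrix (Fin n) (Fin n) ℝ) where
  carrier := {N | orthProj n k x * N = N ∧ N * orthProj n k x = 0}
  add_mem' := by
    rintro a b ⟨h1, h2⟩ ⟨h3, h4⟩
    exact ⟨by rw [Matrix.mul_add, h1, h3], by rw [Matrix.add_mul, h2, h4, add_zero]⟩
  zero_mem' := ⟨Matrix.mul_zero _, Matrix.zero_mul _⟩
  smul_mem' := by
    rintro c a ⟨h1, h2⟩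
    exact ⟨by rw [Matrix.mul_smul, h1], by rw [Matrix.smul_mul, h2, smul_zero]⟩

theorem mem_fibreSpace {x : OQuot n k} {N : Matrix (Fin n) (Fin n) ℝ} :
    N ∈ fibreSpace n k x ↔ orthProj n k x * N = N ∧ N * orthProj n k x = 0 := Iff.rfl

theorem sub_mem_fibreSpace {x : OQuot n k} {y : GLQuot n k} (h : gramSchmidtMap n k y = x) :
    idem n k y - orthProj n k x ∈ fibreSpace n k x := by
  rw [mem_fibreSpace, Matrix.mul_sub, Matrix.sub_mul, orthProj_mul_self,
    (gramSchmidtMap_eq_iff x y).1 h, idem_mul_orthProj x y h, sub_self]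
  exact ⟨rfl, rfl⟩

/-- The two relations force `N² = N (R N) = (N R) N = 0`, so `1 - N` is invertible with inverse `1 +
N`, and `(1 - N) R (1 + N) = R (1 + N) = R + N`. -/
theorem exists_of_mem_fibreSpace {x : OQuot n k} {N : Matrix (Fin n) (Fin n) ℝ}
    (hN : N ∈ fibreSpace n k x) :
    ∃ y, gramSchmidtMap n k y = x ∧ idem n k y = orthProj n k x + N := by
  obtain ⟨h1, h2⟩ := hN
  have hNN : N * N = 0 := by
    rw [← h1, ← Matrix.mul_assoc, Matrix.mul_assoc, Matrix.mul_assoc, ← Matrix.mul_assoc N, h2,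
      Matrix.zero_mul, Matrix.mul_zero]
  have hE : ∃ y, idem n k y = orthProj n k x + N := by
    have hRR := orthProj_mul_self x
    induction x using QuotientGroup.induction_on with
    | H V =>
    let U : GL (Fin n) ℝ := ⟨1 - N, 1 + N, by noncomm_ring [hNN], by noncomm_ring [hNN]⟩
    refine ⟨QuotientGroup.mk (U * Unitary.toUnits V), ?_⟩
    have e : idem n k (QuotientGroup.mk (U * Unitary.toUnits V)) =
        (1 - N) * orthProj n k (QuotientGroup.mk V) * (1 + N) := by
      rw [idem_mk, mul_inv_rev, Units.val_mul, Units.val_mul, toUnits_val, toUnits_inv_val,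
        orthProj_mk]
      show (1 - N) * V.1 * _ * (V.1ᵀ * (1 + N)) = _
      simp only [Matrix.mul_assoc]
    rw [e, Matrix.sub_mul, h2, Matrix.one_mul, sub_zero, Matrix.mul_add, h1, Matrix.mul_one]
  obtain ⟨y, hy⟩ := hE
  refine ⟨y, (gramSchmidtMap_eq_iff x y).2 ?_, hy⟩
  rw [hy, Matrix.mul_add, h1, orthProj_mul_self]

theorem range_mulVecLin_le_iff {Q R : Matrix (Fin n) (Fin n) ℝ} (hR : R * R = R) :
    LinearMap.range Q.mulVecLin ≤ LinearMap.range R.mulVecLin ↔ R * Q = Q := by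
  constructor
  · intro h
    ext i j
    obtain ⟨u, hu⟩ := h ⟨Pi.single j 1, rfl⟩
    have hu' : R *ᵥ u = Q.col j := by simpa using hu
    have h2 : R *ᵥ (R *ᵥ u) = R *ᵥ Q.col j := by rw [hu']
    rw [Matrix.mulVec_mulVec, hR, hu'] at h2
    exact (congrFun h2 i).symm
  · rintro h _ ⟨u, rfl⟩
    exact ⟨Q *ᵥ u, by simp [h]⟩

theorem idem_image_fibre (x : OQuot n k) : idem n k '' (gramSchmidtMap n k ⁻¹' {x}) =
    {Q | Q * Q = Q ∧
      LinearMap.range Q.mulVecLin = LinearMap.range (orthProj n k x).mulVecLin} := by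
  ext Q
  constructor
  · rintro ⟨y, hy, rfl⟩
    refine ⟨idem_mul_self y, le_antisymm ?_ ?_⟩
    · exact (range_mulVecLin_le_iff (orthProj_mul_self x)).2 ((gramSchmidtMap_eq_iff x y).1 hy)
    · exact (range_mulVecLin_le_iff (idem_mul_self y)).2 (idem_mul_orthProj x y hy)
  · rintro ⟨hQ, h⟩
    have h1 := (range_mulVecLin_le_iff (orthProj_mul_self x)).1 h.le
    have h2 := (range_mulVecLin_le_iff hQ).1 h.ge
    have hN : Q - orthProj n k x ∈ fibreSpace n k x := by
      rw [mem_fibreSpace, Matrix.mul_sub, Matrix.sub_mul, h1, h2, orthProj_mul_self, sub_self]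
      exact ⟨rfl, rfl⟩
    obtain ⟨y, hy, hy'⟩ := exists_of_mem_fibreSpace hN
    exact ⟨y, hy, hy'.trans (add_sub_cancel _ _)⟩

/-- The fibre of the Gram-Schmidt map over `x`, as a linear space of matrices. -/
noncomputable def fibreEquiv (x : OQuot n k) : gramSchmidtMap n k ⁻¹' {x} ≃ fibreSpace n k x :=
  Equiv.ofBijective (fun y => ⟨idem n k y.1 - orthProj n k x, sub_mem_fibreSpace y.2⟩) <| by
    constructor
    · intro y y' h
      exact Subtype.ext (idem_injective (sub_left_injective (congrArg Subtype.val h)))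
    · rintro ⟨N, hN⟩
      obtain ⟨y, hy, hy'⟩ := exists_of_mem_fibreSpace hN
      exact ⟨⟨y, hy⟩, Subtype.ext (by simp [hy'])⟩

/-! #### Coordinates read off from the idempotents -/

theorem blkA_conj (G H : Matrix (Fin n) (Fin n) ℝ) :
    blkA k (G * diagProj n k * H) = blkA k G * blkA k H := by
  simp [blkA_mul, blkB_mul, blkA_diagProj, blkB_diagProj, blkC_diagProj, blkD_diagProj]

theorem blkC_conj (G H : Matrix (Fin n) (Fin n) ℝ) :
    blkC k (G * diagProj n k * H) = blkC k G * blkA k H := by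
  simp [blkC_mul, blkD_mul, blkA_diagProj, blkB_diagProj, blkC_diagProj, blkD_diagProj]

theorem blk_one : blkA k (1 : Matrix (Fin n) (Fin n) ℝ) = 1 ∧
    blkB k (1 : Matrix (Fin n) (Fin n) ℝ) = 0 ∧ blkC k (1 : Matrix (Fin n) (Fin n) ℝ) = 0 ∧
    blkD k (1 : Matrix (Fin n) (Fin n) ℝ) = 1 := by
  refine ⟨?_, ?_, ?_, ?_⟩ <;> ext ⟨i, hi⟩ ⟨j, hj⟩
  · simp [blkA, Matrix.one_apply]
  · have : i ≠ j := by rintro rfl; exact hj hi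
    simp [blkB, this]
  · have : i ≠ j := by rintro rfl; exact hi hj
    simp [blkC, this]
  · simp [blkD, Matrix.one_apply]

theorem blk_sub (M N : Matrix (Fin n) (Fin n) ℝ) : blkA k (M - N) = blkA k M - blkA k N ∧
    blkB k (M - N) = blkB k M - blkB k N ∧ blkC k (M - N) = blkC k M - blkC k N ∧
    blkD k (M - N) = blkD k M - blkD k N := ⟨rfl, rfl, rfl, rfl⟩

theorem blkB_conj_compl (G H : Matrix (Fin n) (Fin n) ℝ) :
    blkB k (G * (1 - diagProj n k) * H) = blkB k G * blkD k H := by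
  simp [blkA_mul, blkB_mul, blk_sub, blk_one, blkA_diagProj, blkB_diagProj, blkC_diagProj,
    blkD_diagProj]

theorem blkD_conj_compl (G H : Matrix (Fin n) (Fin n) ℝ) :
    blkD k (G * (1 - diagProj n k) * H) = blkD k G * blkD k H := by
  simp [blkC_mul, blkD_mul, blk_sub, blk_one, blkA_diagProj, blkB_diagProj, blkC_diagProj,
    blkD_diagProj]

/-- The first block column of `G P H` is that of `G` times the block `A` of `H`. When the latter is
invertible it cancels in `C A⁻¹`, so the slope of the range is visible on the idempotent itself. -/
theorem slopeLow_conj {G H : Matrix (Fin n) (Fin n) ℝ}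
    (h : (blkA k (G * diagProj n k * H)).det ≠ 0) :
    (blkA k G).det ≠ 0 ∧ slopeLow k (G * diagProj n k * H) = slopeLow k G := by
  have h' := h
  rw [blkA_conj, Matrix.det_mul] at h'
  refine ⟨left_ne_zero_of_mul h', ?_⟩
  rw [slopeLow, blkA_conj, blkC_conj]
  exact slope_cancel _ _ _ (right_ne_zero_of_mul h')

/-- The same cancellation for the complementary idempotent, whose range is the kernel of the
original one when `H = G⁻¹`. -/
theorem slopeHigh_conj {G H : Matrix (Fin n) (Fin n) ℝ}
    (h : (blkD k (G * (1 - diagProj n k) * H)).det ≠ 0) :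
    (blkD k G).det ≠ 0 ∧ slopeHigh k (G * (1 - diagProj n k) * H) = slopeHigh k G := by
  have h' := h
  rw [blkD_conj_compl, Matrix.det_mul] at h'
  refine ⟨left_ne_zero_of_mul h', ?_⟩
  rw [slopeHigh, blkD_conj_compl, blkB_conj_compl]
  exact slope_cancel _ _ _ (right_ne_zero_of_mul h')

/-- Near `[W]`, the chart of `GL_n(ℝ) / (GL_k × GL_{n-k})` is a function of the idempotent. -/
theorem chartGL_eq (W : GL (Fin n) ℝ) (y : GLQuot n k)
    (hA : (blkA k ((W⁻¹).1 * idem n k y * W.1)).det ≠ 0)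
    (hD : (blkD k (1 - (W⁻¹).1 * idem n k y * W.1)).det ≠ 0) :
    y ∈ (chartGL (k := k) W).source ∧ chartGL W y =
      (slopeLow k ((W⁻¹).1 * idem n k y * W.1),
        slopeHigh k (1 - (W⁻¹).1 * idem n k y * W.1)) := by
  induction y using QuotientGroup.induction_on with
  | H W' =>
  have e : (W⁻¹).1 * idem n k (QuotientGroup.mk W') * W.1 =
      (W⁻¹ * W').1 * diagProj n k * ((W⁻¹ * W')⁻¹).1 := by
    rw [idem_mk, mul_inv_rev, inv_inv, Units.val_mul, Units.val_mul]
    simp only [Matrix.mul_assoc]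
  have e' : 1 - (W⁻¹).1 * idem n k (QuotientGroup.mk W') * W.1 =
      (W⁻¹ * W').1 * (1 - diagProj n k) * ((W⁻¹ * W')⁻¹).1 := by
    rw [e, Matrix.mul_sub, Matrix.sub_mul, Matrix.mul_one, Units.mul_inv]
  rw [e] at hA
  rw [e'] at hD
  rw [e', e, (slopeLow_conj hA).2, (slopeHigh_conj hD).2]
  exact ⟨⟨(slopeLow_conj hA).1, (slopeHigh_conj hD).1⟩, rfl⟩

/-- Near `[V]`, the chart of `O_n / (O_k × O_{n-k})` is a function of the orthogonal projection. -/
theorem chartO_eq (V : Matrix.orthogonalGroup (Fin n) ℝ) (x : OQuot n k)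
    (hA : (blkA k (V.1ᵀ * orthProj n k x * V.1)).det ≠ 0) :
    x ∈ (chartO (k := k) V).source ∧
      chartO V x = slopeLow k (V.1ᵀ * orthProj n k x * V.1) := by
  induction x using QuotientGroup.induction_on with
  | H V' =>
  have e : V.1ᵀ * orthProj n k (QuotientGroup.mk V') * V.1 =
      (V⁻¹ * V').1 * diagProj n k * (V'⁻¹ * V).1 := by
    rw [orthProj_mk]
    show _ = V.1ᵀ * V'.1 * diagProj n k * (V'.1ᵀ * V.1)
    simp only [Matrix.mul_assoc]
  rw [e] at hA
  rw [e, (slopeLow_conj hA).2]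
  exact ⟨(slopeLow_conj hA).1, rfl⟩

end algebra

/-! ### Analytic families of matrices -/

section analytic

variable {E H M : Type} [NormedAddCommGroup E] [NormedSpace ℝ E] [TopologicalSpace H]
  [TopologicalSpace M] [ChartedSpace H M] {l m p : Type}

/-- A family of matrices, indexed by a manifold, has analytic entries. -/
def EntriesAnalyticAt (I : ModelWithCorners ℝ E H) (f : M → Matrix l m ℝ) (x : M) : Prop :=
  ∀ i j, ContMDiffAt I 𝓘(ℝ, ℝ) ω (fun y => f y i j) x

variable {I : ModelWithCorners ℝ E H} {x : M}

theorem entriesAnalyticAt_iff [Fintype l] [Fintype m] {f : M → Matrix l m ℝ} :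
    EntriesAnalyticAt I f x ↔
      ContMDiffAt (M' := l → m → ℝ) I 𝓘(ℝ, l → m → ℝ) ω f x := by
  refine Iff.trans ?_ contMDiffAt_pi_space.symm
  exact forall_congr' fun i => contMDiffAt_pi_space.symm

theorem entriesAnalyticAt_const (A : Matrix l m ℝ) : EntriesAnalyticAt I (fun _ : M => A) x :=
  fun _ _ => contMDiffAt_const

theorem EntriesAnalyticAt.congr {f g : M → Matrix l m ℝ} (hf : EntriesAnalyticAt I f x)
    (h : g =ᶠ[𝓝 x] f) : EntriesAnalyticAt I g x :=
  fun i j => (hf i j).congr_of_eventuallyEq (h.mono fun _ hy => congrFun (congrFun hy i) j)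

theorem EntriesAnalyticAt.sub {f g : M → Matrix l m ℝ} (hf : EntriesAnalyticAt I f x)
    (hg : EntriesAnalyticAt I g x) : EntriesAnalyticAt I (fun y => f y - g y) x :=
  fun i j => (hf i j).sub (hg i j)

theorem EntriesAnalyticAt.add {f g : M → Matrix l m ℝ} (hf : EntriesAnalyticAt I f x)
    (hg : EntriesAnalyticAt I g x) : EntriesAnalyticAt I (fun y => f y + g y) x :=
  fun i j => (hf i j).add (hg i j)

theorem EntriesAnalyticAt.transpose {f : M → Matrix l m ℝ} (hf : EntriesAnalyticAt I f x) :
    EntriesAnalyticAt I (fun y => (f y)ᵀ) x :=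
  fun i j => hf j i

theorem EntriesAnalyticAt.mul [Fintype m] {f : M → Matrix l m ℝ} {g : M → Matrix m p ℝ}
    (hf : EntriesAnalyticAt I f x) (hg : EntriesAnalyticAt I g x) :
    EntriesAnalyticAt I (fun y => f y * g y) x := by
  intro i j
  simp only [Matrix.mul_apply]
  exact contMDiffAt_finsetSum fun a _ => (hf i a).mul (hg a j)

theorem EntriesAnalyticAt.comp_contDiffAt [Fintype l] [Fintype m] {l' m' : Type}
    {F : Matrix l m ℝ → Matrix l' m' ℝ} {f : M → Matrix l m ℝ}
    (hF : ∀ i j, ContDiffAt ℝ ω (fun A : l → m → ℝ => F A i j) (f x))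
    (hf : EntriesAnalyticAt I f x) : EntriesAnalyticAt I (fun y => F (f y)) x :=
  fun i j => (hF i j).contMDiffAt.comp x (entriesAnalyticAt_iff.1 hf)

theorem contDiffAt_entry [Fintype l] [Fintype m] (A : l → m → ℝ) (i : l) (j : m) :
    ContDiffAt ℝ ω (fun A : l → m → ℝ => A i j) A :=
  (contDiff_apply_apply ℝ ℝ i j).contDiffAt

theorem EntriesAnalyticAt.inv [Fintype l] [DecidableEq l] {f : M → Matrix l l ℝ}
    (hf : EntriesAnalyticAt I f x) (hx : (f x).det ≠ 0) :
    EntriesAnalyticAt I (fun y => (f y)⁻¹) x := by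
  refine hf.comp_contDiffAt (F := fun A => A⁻¹) fun i j => ?_
  -- The inverse is the slope `C A⁻¹` with `C = 1`.
  have := contDiffAt_slope (C := fun _ : l → l → ℝ => (1 : Matrix l l ℝ))
    (A := fun A : l → l → ℝ => A) (x := f x) (fun i j => contDiffAt_const)
    (fun i j => contDiffAt_entry _ i j) hx
  simp only [Matrix.one_mul] at this
  exact contDiffAt_pi.1 (contDiffAt_pi.1 this i) j

theorem EntriesAnalyticAt.continuousAt {f : M → Matrix l m ℝ} (hf : EntriesAnalyticAt I f x) :
    ContinuousAt f x :=
  continuousAt_pi.2 fun i => continuousAt_pi.2 fun j => (hf i j).continuousAt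

theorem EntriesAnalyticAt.eventually_det_ne_zero [Fintype l] [DecidableEq l]
    {f : M → Matrix l l ℝ} (hf : EntriesAnalyticAt I f x) (hx : (f x).det ≠ 0) :
    ∀ᶠ y in 𝓝 x, (f y).det ≠ 0 := by
  have hc : Continuous fun A : Matrix l l ℝ => A.det := continuous_id.matrix_det
  exact (hc.continuousAt.comp hf.continuousAt).eventually_ne hx

variable {n k : ℕ} {f : M → Matrix (Fin n) (Fin n) ℝ}

theorem EntriesAnalyticAt.blkA (hf : EntriesAnalyticAt I f x) :
    EntriesAnalyticAt I (fun y => GramSchmidtBundle.blkA k (f y)) x := fun i j => hf i.1 j.1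

theorem EntriesAnalyticAt.blkB (hf : EntriesAnalyticAt I f x) :
    EntriesAnalyticAt I (fun y => GramSchmidtBundle.blkB k (f y)) x := fun i j => hf i.1 j.1

theorem EntriesAnalyticAt.blkC (hf : EntriesAnalyticAt I f x) :
    EntriesAnalyticAt I (fun y => GramSchmidtBundle.blkC k (f y)) x := fun i j => hf i.1 j.1

theorem EntriesAnalyticAt.blkD (hf : EntriesAnalyticAt I f x) :
    EntriesAnalyticAt I (fun y => GramSchmidtBundle.blkD k (f y)) x := fun i j => hf i.1 j.1

theorem EntriesAnalyticAt.slopeLow (hf : EntriesAnalyticAt I f x)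
    (hx : (GramSchmidtBundle.blkA k (f x)).det ≠ 0) :
    ContMDiffAt I 𝓘(ℝ, ModelO n k) ω (fun y => GramSchmidtBundle.slopeLow k (f y)) x :=
  entriesAnalyticAt_iff.1 (hf.blkC.mul (hf.blkA.inv hx))

theorem EntriesAnalyticAt.slopeHigh (hf : EntriesAnalyticAt I f x)
    (hx : (GramSchmidtBundle.blkD k (f x)).det ≠ 0) :
    ContMDiffAt I 𝓘(ℝ, LowIdx n k → HighIdx n k → ℝ) ω
      (fun y => GramSchmidtBundle.slopeHigh k (f y)) x :=
  entriesAnalyticAt_iff.1 (hf.blkB.mul (hf.blkD.inv hx))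

theorem entriesAnalyticAt_glue {T : M → ModelO n k} {S : M → LowIdx n k → HighIdx n k → ℝ}
    (hT : ContMDiffAt I 𝓘(ℝ, ModelO n k) ω T x)
    (hS : ContMDiffAt I 𝓘(ℝ, LowIdx n k → HighIdx n k → ℝ) ω S x) :
    EntriesAnalyticAt I (fun y => glue (T y, S y)) x := by
  have hT' := entriesAnalyticAt_iff (f := T).2 hT
  have hS' := entriesAnalyticAt_iff (f := S).2 hS
  intro i j
  simp only [glue, Matrix.of_apply]
  split_ifs
  · exact contMDiffAt_const
  · exact contMDiffAt_const
  · exact hS' _ _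
  · exact hT' _ _
  · exact contMDiffAt_const
  · exact contMDiffAt_const

/-! #### The Gram-Schmidt process -/

/-- Strong induction along the recursion that defines the process. Linear independence is required
at `a` only: it makes the squared norms in the denominators nonzero there. -/
theorem contDiffAt_gramSchmidt {F V ι : Type} [NormedAddCommGroup F] [NormedSpace ℝ F]
    [NormedAddCommGroup V] [InnerProductSpace ℝ V] [LinearOrder ι] [LocallyFiniteOrderBot ι]
    [WellFoundedLT ι] {v : F → ι → V} {a : F} (hv : ∀ j, ContDiffAt ℝ ω (fun y => v y j) a)
    (h : LinearIndependent ℝ (v a)) (j : ι) :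
    ContDiffAt ℝ ω (fun y => InnerProductSpace.gramSchmidt ℝ (v y) j) a := by
  induction j using WellFoundedLT.induction with
  | ind j ih =>
  simp only [fun y => InnerProductSpace.gramSchmidt_def ℝ (v y) j,
    Submodule.starProjection_singleton]
  refine (hv j).sub (ContDiffAt.sum fun i hi => ?_)
  have hi' := ih i (Finset.mem_Iio.1 hi)
  have hne := InnerProductSpace.gramSchmidt_ne_zero i h
  refine ContDiffAt.smul (ContDiffAt.div (hi'.inner ℝ (hv j)) ?_ ?_) hi'
  · exact (hi'.norm ℝ hne).pow 2
  · simpa using hne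

theorem contDiffAt_gramSchmidtNormed {F V ι : Type} [NormedAddCommGroup F] [NormedSpace ℝ F]
    [NormedAddCommGroup V] [InnerProductSpace ℝ V] [LinearOrder ι] [LocallyFiniteOrderBot ι]
    [WellFoundedLT ι] {v : F → ι → V} {a : F} (hv : ∀ j, ContDiffAt ℝ ω (fun y => v y j) a)
    (h : LinearIndependent ℝ (v a)) (j : ι) :
    ContDiffAt ℝ ω (fun y => InnerProductSpace.gramSchmidtNormed ℝ (v y) j) a := by
  have hj := contDiffAt_gramSchmidt hv h j
  have hne := InnerProductSpace.gramSchmidt_ne_zero j h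
  exact ((hj.norm ℝ hne).inv (norm_ne_zero_iff.2 hne)).smul hj

theorem EntriesAnalyticAt.gsMatrix (hf : EntriesAnalyticAt I f x) (hx : (f x).det ≠ 0) :
    EntriesAnalyticAt I (fun y => GramSchmidtBundle.gsMatrix (f y)) x := by
  refine hf.comp_contDiffAt (F := GramSchmidtBundle.gsMatrix) fun i j => ?_
  have hcol : ∀ j : Fin n, ContDiffAt ℝ ω (fun A : Fin n → Fin n → ℝ => colVec A j) (f x) :=
    fun j => contDiffAt_piLp' 2 fun i => contDiffAt_entry _ i j
  have hli : LinearIndependent ℝ (colVec (f x)) := by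
    have := linearIndependent_colVec (toGL (f x))
    rwa [toGL_val hx] at this
  exact contDiffAt_pi.1 ((PiLp.contDiff_ofLp (p := 2)).contDiffAt.comp _
    (contDiffAt_gramSchmidtNormed hcol hli j)) i

theorem gsMatrix_orthogonal (V : Matrix.orthogonalGroup (Fin n) ℝ) : gsMatrix V.1 = V.1 := by
  have ho : Orthonormal ℝ (colVec V.1) := by
    rw [orthonormal_iff_ite]
    intro i j
    rw [inner_eq_sum, ← Matrix.one_apply, ← transpose_mul_orthogonal V]
    rfl
  ext i j
  rw [gsMatrix, Matrix.of_apply, InnerProductSpace.gramSchmidtNormed,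
    InnerProductSpace.gramSchmidt_of_orthogonal ℝ ho.2, ho.1 j]
  simp [colVec]

/-- This equality of matrices, finer than the equality of classes in `mk_gs_toUnits`, lets the local
sections of the quotient map of `O_n` pass through a prescribed `V`. -/
theorem gramSchmidtGL_toUnits (V : Matrix.orthogonalGroup (Fin n) ℝ) :
    gramSchmidtGL (Unitary.toUnits V) = V := Subtype.ext (gsMatrix_orthogonal V)

end analytic

/-! ### Analyticity of the maps between the homogeneous spaces -/

section maps

variable {n k : ℕ}

/-- The inverse of the chart, read as a local section of the quotient map. -/
theorem chartGL_rep (W : GL (Fin n) ℝ) {y : GLQuot n k} (hy : y ∈ (chartGL (k := k) W).source) :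
    (glue (chartGL W y)).det ≠ 0 ∧ QuotientGroup.mk (W * toGL (glue (chartGL W y))) = y := by
  refine ⟨(chartGL W).map_source hy, ?_⟩
  have h : (W⁻¹)⁻¹ • (QuotientGroup.mk (toGL (glue (chartGL W y))) : GLQuot n k) = y :=
    (chartGL W).left_inv hy
  rwa [inv_inv] at h

theorem chartO_rep (V : Matrix.orthogonalGroup (Fin n) ℝ) {x : OQuot n k}
    (hx : x ∈ (chartO (k := k) V).source) :
    QuotientGroup.mk (V * gramSchmidtGL (toGL (glue (chartO V x, 0)))) = x := by
  have h : (V⁻¹)⁻¹ • (QuotientGroup.mk (gramSchmidtGL (toGL (glue (chartO V x, 0)))) :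
      OQuot n k) = x := (chartO V).left_inv hx
  rwa [inv_inv] at h

theorem glue_zero : glue (0 : ModelGL n k) = 1 :=
  blk_ext (k := k) ((blkA_glue _).trans blk_one.1.symm) ((blkB_glue _).trans blk_one.2.1.symm)
    ((blkC_glue _).trans blk_one.2.2.1.symm) ((blkD_glue _).trans blk_one.2.2.2.symm)

theorem chartGL_center (W : GL (Fin n) ℝ) :
    (QuotientGroup.mk W : GLQuot n k) ∈ (chartGL (k := k) W).source ∧
      chartGL (k := k) W (QuotientGroup.mk W) = 0 := by
  have e : (W⁻¹).1 * idem n k (QuotientGroup.mk W) * W.1 = diagProj n k := by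
    rw [idem_mk]; simp [Matrix.mul_assoc]
  have h := chartGL_eq (k := k) W (QuotientGroup.mk W)
  rw [e, blkA_diagProj, (blk_sub _ _).2.2.2, blk_one.2.2.2, blkD_diagProj, sub_zero,
    Matrix.det_one, Matrix.det_one] at h
  obtain ⟨h1, h2⟩ := h one_ne_zero one_ne_zero
  refine ⟨h1, h2.trans (Prod.ext ?_ ?_)⟩
  · show blkC k _ * _ = 0
    rw [blkC_diagProj, Matrix.zero_mul]
  · show blkB k _ * _ = 0
    rw [(blk_sub _ _).2.1, blk_one.2.1, blkB_diagProj, sub_zero, Matrix.zero_mul]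

theorem conj_orthProj_mk (V : Matrix.orthogonalGroup (Fin n) ℝ) :
    V.1ᵀ * orthProj n k (QuotientGroup.mk V) * V.1 = diagProj n k := by
  rw [orthProj_mk, ← Matrix.mul_assoc, ← Matrix.mul_assoc, transpose_mul_orthogonal,
    Matrix.one_mul, Matrix.mul_assoc, transpose_mul_orthogonal, Matrix.mul_one]

theorem chartO_center (V : Matrix.orthogonalGroup (Fin n) ℝ) :
    (QuotientGroup.mk V : OQuot n k) ∈ (chartO (k := k) V).source ∧
      chartO (k := k) V (QuotientGroup.mk V) = 0 := by
  have h := chartO_eq (k := k) V (QuotientGroup.mk V)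
  rw [conj_orthProj_mk, blkA_diagProj, Matrix.det_one] at h
  obtain ⟨h1, h2⟩ := h one_ne_zero
  refine ⟨h1, h2.trans ?_⟩
  show blkC k _ * _ = 0
  rw [blkC_diagProj, Matrix.zero_mul]

theorem chartGL_mem (W : GL (Fin n) ℝ) : chartGL (k := k) W ∈
    IsManifold.maximalAtlas 𝓘(ℝ, ModelGL n k) ω (GLQuot n k) :=
  IsManifold.subset_maximalAtlas ⟨W, rfl⟩

theorem chartO_mem (V : Matrix.orthogonalGroup (Fin n) ℝ) : chartO (k := k) V ∈
    IsManifold.maximalAtlas 𝓘(ℝ, ModelO n k) ω (OQuot n k) :=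
  IsManifold.subset_maximalAtlas ⟨V, rfl⟩

theorem contMDiffAt_chartGL (W : GL (Fin n) ℝ) : ContMDiffAt 𝓘(ℝ, ModelGL n k) 𝓘(ℝ, ModelGL n k) ω
    (chartGL (k := k) W) (QuotientGroup.mk W) :=
  (contMDiffOn_of_mem_maximalAtlas (chartGL_mem W)).contMDiffAt
    ((chartGL W).open_source.mem_nhds (chartGL_center W).1)

theorem contMDiffAt_chartO (V : Matrix.orthogonalGroup (Fin n) ℝ) :
    ContMDiffAt 𝓘(ℝ, ModelO n k) 𝓘(ℝ, ModelO n k) ω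
      (chartO (k := k) V) (QuotientGroup.mk V) :=
  (contMDiffOn_of_mem_maximalAtlas (chartO_mem V)).contMDiffAt
    ((chartO V).open_source.mem_nhds (chartO_center V).1)

/-- An analytic family of invertible matrices representing the points near `[W]`. -/
theorem entriesAnalyticAt_repGL (W : GL (Fin n) ℝ) : EntriesAnalyticAt 𝓘(ℝ, ModelGL n k)
    (fun y : GLQuot n k => W.1 * glue (chartGL W y)) (QuotientGroup.mk W) :=
  (entriesAnalyticAt_const _).mul
    (entriesAnalyticAt_glue
      (contDiff_fst.contMDiff.contMDiffAt.comp _ (contMDiffAt_chartGL W))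
      (contDiff_snd.contMDiff.contMDiffAt.comp _ (contMDiffAt_chartGL W)))

theorem repGL_center (W : GL (Fin n) ℝ) :
    W.1 * glue (chartGL (k := k) W (QuotientGroup.mk W)) = W.1 := by
  rw [(chartGL_center W).2, glue_zero, Matrix.mul_one]

theorem det_ne_zero_GL (W : GL (Fin n) ℝ) : W.1.det ≠ 0 :=
  ((Matrix.isUnit_iff_isUnit_det _).1 W.isUnit).ne_zero

/-- Near `[W]` the idempotent is `M P M⁻¹`, with `M = W * glue (chartGL W y)` an analytic family of
invertible matrices. -/
theorem entriesAnalyticAt_idem (y : GLQuot n k) :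
    EntriesAnalyticAt 𝓘(ℝ, ModelGL n k) (idem n k) y := by
  induction y using QuotientGroup.induction_on with
  | H W =>
  have hr := entriesAnalyticAt_repGL (k := k) W
  have hd : (W.1 * glue (chartGL (k := k) W (QuotientGroup.mk W))).det ≠ 0 := by
    rw [repGL_center]; exact det_ne_zero_GL W
  refine ((hr.mul (entriesAnalyticAt_const (diagProj n k))).mul (hr.inv hd)).congr ?_
  filter_upwards [(chartGL W).open_source.mem_nhds (chartGL_center (k := k) W).1] with y hy
  obtain ⟨h1, h2⟩ := chartGL_rep W hy
  conv_lhs => rw [← h2, idem_mk, Matrix.coe_units_inv, Units.val_mul, toGL_val h1]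

/-- An analytic family of orthogonal matrices representing the points near `[V]`. -/
theorem entriesAnalyticAt_repO (V : Matrix.orthogonalGroup (Fin n) ℝ) :
    EntriesAnalyticAt 𝓘(ℝ, ModelO n k)
      (fun x : OQuot n k => (V * gramSchmidtGL (toGL (glue (chartO V x, 0)))).1)
      (QuotientGroup.mk V) := by
  have h := entriesAnalyticAt_glue (contMDiffAt_chartO (k := k) V) contMDiffAt_const
    (S := fun _ => 0)
  refine ((entriesAnalyticAt_const V.1).mul (h.gsMatrix (det_glue_zero _))).congr ?_
  refine Filter.Eventually.of_forall fun x => ?_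
  show V.1 * gsMatrix (toGL (glue (chartO V x, 0))).1 = _
  rw [toGL_val (det_glue_zero _)]

theorem toGL_unit (W : GL (Fin n) ℝ) : toGL W.1 = W := Units.ext (toGL_val (det_ne_zero_GL W))

theorem repO_center (V : Matrix.orthogonalGroup (Fin n) ℝ) :
    V * gramSchmidtGL (toGL (glue (chartO (k := k) V (QuotientGroup.mk V), 0))) = V := by
  rw [(chartO_center V).2]
  have : glue ((0, 0) : ModelGL n k) = (Unitary.toUnits (1 : Matrix.orthogonalGroup (Fin n) ℝ)).1 :=
    glue_zero
  rw [this, toGL_unit, gramSchmidtGL_toUnits, mul_one]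

theorem entriesAnalyticAt_orthProj (x : OQuot n k) :
    EntriesAnalyticAt 𝓘(ℝ, ModelO n k) (orthProj n k) x := by
  induction x using QuotientGroup.induction_on with
  | H V =>
  have hr := entriesAnalyticAt_repO (k := k) V
  refine ((hr.mul (entriesAnalyticAt_const (diagProj n k))).mul hr.transpose).congr ?_
  filter_upwards [(chartO V).open_source.mem_nhds (chartO_center (k := k) V).1] with x hx
  conv_lhs => rw [← chartO_rep V hx, orthProj_mk]

/-! ### Analyticity of maps into the homogeneous spaces, tested on idempotents -/

section criteria

variable {E H M : Type} [NormedAddCommGroup E] [NormedSpace ℝ E] [TopologicalSpace H]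
  [TopologicalSpace M] [ChartedSpace H M] {I : ModelWithCorners ℝ E H} {a : M}

/-- Take the chart centred at `f a`. By `chartGL_eq`, near `a` the map `f` is the inverse chart
applied to the slopes of `W⁻¹ Q W` and `1 - W⁻¹ Q W`, where `Q` is the idempotent of `f z`. -/
theorem contMDiffAt_of_idem {f : M → GLQuot n k}
    (hf : EntriesAnalyticAt I (fun z => idem n k (f z)) a) :
    ContMDiffAt I 𝓘(ℝ, ModelGL n k) ω f a := by
  obtain ⟨W, hW⟩ := QuotientGroup.mk_surjective (f a)
  have hM : EntriesAnalyticAt I (fun z => (W⁻¹).1 * idem n k (f z) * W.1) a :=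
    ((entriesAnalyticAt_const _).mul hf).mul (entriesAnalyticAt_const _)
  have hM' := (entriesAnalyticAt_const (I := I) (x := a) (1 : Matrix (Fin n) (Fin n) ℝ)).sub hM
  have e : (W⁻¹).1 * idem n k (f a) * W.1 = diagProj n k := by
    rw [← hW, idem_mk]; simp [Matrix.mul_assoc]
  have hA : (blkA k ((W⁻¹).1 * idem n k (f a) * W.1)).det ≠ 0 := by
    rw [e, blkA_diagProj, Matrix.det_one]; exact one_ne_zero
  have hD : (blkD k (1 - (W⁻¹).1 * idem n k (f a) * W.1)).det ≠ 0 := by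
    rw [e, (blk_sub _ _).2.2.2, blk_one.2.2.2, blkD_diagProj, sub_zero, Matrix.det_one]
    exact one_ne_zero
  have hp := (hM.slopeLow hA).prodMk_space (hM'.slopeHigh hD)
  have hc := chartGL_center (k := k) W
  have hsymm : ContMDiffAt 𝓘(ℝ, ModelGL n k) 𝓘(ℝ, ModelGL n k) ω (chartGL (k := k) W).symm
      (slopeLow k ((W⁻¹).1 * idem n k (f a) * W.1),
        slopeHigh k (1 - (W⁻¹).1 * idem n k (f a) * W.1)) := by
    rw [← (chartGL_eq W (f a) hA hD).2]
    refine (contMDiffOn_symm_of_mem_maximalAtlas (chartGL_mem W)).contMDiffAt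
      ((chartGL W).open_target.mem_nhds ((chartGL W).map_source ?_))
    rw [← hW]; exact hc.1
  refine (hsymm.comp a hp).congr_of_eventuallyEq ?_
  -- Continuity of `f` is not presupposed: lying in the chart domain follows from two determinants
  -- of the idempotents being nonzero, which is an open condition by hypothesis `hf`.
  filter_upwards [hM.blkA.eventually_det_ne_zero hA,
    hM'.blkD.eventually_det_ne_zero hD]
    with z h1 h2
  obtain ⟨h3, h4⟩ := chartGL_eq W (f z) h1 h2
  rw [← (chartGL W).left_inv h3, h4]
  rfl

theorem contMDiffAt_of_orthProj {f : M → OQuot n k}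
    (hf : EntriesAnalyticAt I (fun z => orthProj n k (f z)) a) :
    ContMDiffAt I 𝓘(ℝ, ModelO n k) ω f a := by
  obtain ⟨V, hV⟩ := QuotientGroup.mk_surjective (f a)
  have hM : EntriesAnalyticAt I (fun z => V.1ᵀ * orthProj n k (f z) * V.1) a :=
    ((entriesAnalyticAt_const _).mul hf).mul (entriesAnalyticAt_const _)
  have hA : (blkA k (V.1ᵀ * orthProj n k (f a) * V.1)).det ≠ 0 := by
    rw [← hV, conj_orthProj_mk, blkA_diagProj, Matrix.det_one]; exact one_ne_zero
  have hsymm : ContMDiffAt 𝓘(ℝ, ModelO n k) 𝓘(ℝ, ModelO n k) ω (chartO (k := k) V).symm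
      (slopeLow k (V.1ᵀ * orthProj n k (f a) * V.1)) :=
    (contMDiffOn_symm_of_mem_maximalAtlas (chartO_mem V)).contMDiffAt
      ((chartO V).open_target.mem_nhds (Set.mem_univ _))
  refine (hsymm.comp a (hM.slopeLow hA)).congr_of_eventuallyEq ?_
  filter_upwards [hM.blkA.eventually_det_ne_zero hA]
    with z h1
  obtain ⟨h3, h4⟩ := chartO_eq V (f z) h1
  rw [← (chartO V).left_inv h3, h4]
  rfl

end criteria

theorem orthProj_gramSchmidtMap_mk (W : GL (Fin n) ℝ) :
    orthProj n k (gramSchmidtMap n k (QuotientGroup.mk W)) =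
      gsMatrix W.1 * diagProj n k * (gsMatrix W.1)ᵀ := rfl

/-- The orthogonal projection of `υ [W]` is `V P Vᵀ` with `V` the Gram-Schmidt matrix of `W`, and
the process is analytic along the family representing the points near `[W]`. -/
theorem contMDiff_gramSchmidtMap :
    ContMDiff 𝓘(ℝ, ModelGL n k) 𝓘(ℝ, ModelO n k) ω (gramSchmidtMap n k) := by
  intro y
  induction y using QuotientGroup.induction_on with
  | H W =>
  apply contMDiffAt_of_orthProj
  have hd : (W.1 * glue (chartGL (k := k) W (QuotientGroup.mk W))).det ≠ 0 := by
    rw [repGL_center]; exact det_ne_zero_GL W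
  have hr := (entriesAnalyticAt_repGL (k := k) W).gsMatrix hd
  refine ((hr.mul (entriesAnalyticAt_const (diagProj n k))).mul hr.transpose).congr ?_
  filter_upwards [(chartGL W).open_source.mem_nhds (chartGL_center (k := k) W).1] with y hy
  obtain ⟨h1, h2⟩ := chartGL_rep W hy
  conv_lhs => rw [← h2, orthProj_gramSchmidtMap_mk, Units.val_mul, toGL_val h1]

theorem gramSchmidtMap_surjective : Function.Surjective (gramSchmidtMap n k) := by
  intro x
  induction x using QuotientGroup.induction_on with
  | H V => exact ⟨QuotientGroup.mk (Unitary.toUnits V), mk_gs_toUnits V⟩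

theorem t2Space_GLQuot : T2Space (GLQuot n k) :=
  T2Space.of_injective_continuous idem_injective
    (continuous_iff_continuousAt.2 fun y => (entriesAnalyticAt_idem y).continuousAt)

theorem t2Space_OQuot : T2Space (OQuot n k) :=
  T2Space.of_injective_continuous orthProj_injective
    (continuous_iff_continuousAt.2 fun x => (entriesAnalyticAt_orthProj x).continuousAt)

/-! #### The quotient maps -/

theorem entriesAnalyticAt_id (A : Fin n → Fin n → ℝ) :
    EntriesAnalyticAt 𝓘(ℝ, Fin n → Fin n → ℝ) (fun B : Fin n → Fin n → ℝ => B) A :=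
  fun i j => (contDiffAt_entry A i j).contMDiffAt

theorem contMDiffAt_mk_toGL (W : GL (Fin n) ℝ) :
    ContMDiffAt 𝓘(ℝ, Fin n → Fin n → ℝ) 𝓘(ℝ, ModelGL n k) ω
      (fun A : Fin n → Fin n → ℝ => (QuotientGroup.mk (toGL A) : GLQuot n k))
      (fun i j => W.1 i j) := by
  apply contMDiffAt_of_idem
  have hid := entriesAnalyticAt_id (fun i j => W.1 i j)
  have hW : Matrix.det (fun i j => W.1 i j) ≠ 0 := det_ne_zero_GL W
  refine ((hid.mul (entriesAnalyticAt_const (diagProj n k))).mul (hid.inv hW)).congr ?_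
  -- The matrices near `W` are invertible, so the default value of `toGL` plays no role.
  filter_upwards [hid.eventually_det_ne_zero hW] with A hA
  rw [idem_mk, Matrix.coe_units_inv, toGL_val hA]

theorem isAnalyticSubmersion_GL : IsAnalyticSubmersion (E := ModelGL n k)
    (fun (W : GL (Fin n) ℝ) i j => W.1 i j)
    (QuotientGroup.mk : GL (Fin n) ℝ → GLQuot n k) := by
  intro W
  refine ⟨⟨fun A => QuotientGroup.mk (toGL A), contMDiffAt_mk_toGL W,
    Filter.Eventually.of_forall fun W' => congrArg QuotientGroup.mk (toGL_unit W')⟩,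
    fun y => W * toGL (glue (chartGL W y)), ?_, ?_, ?_⟩
  · apply Units.ext
    show (W * toGL (glue (chartGL (k := k) W (QuotientGroup.mk W)))).1 = W.1
    rw [(chartGL_center W).2, glue_zero, Units.val_mul, toGL_val (by simp), Matrix.mul_one]
  · refine entriesAnalyticAt_iff.1 ((entriesAnalyticAt_repGL W).congr ?_)
    filter_upwards [(chartGL W).open_source.mem_nhds (chartGL_center (k := k) W).1] with y hy
    show (W * toGL (glue (chartGL W y))).1 = _
    rw [Units.val_mul, toGL_val (chartGL_rep W hy).1]
  · filter_upwards [(chartGL W).open_source.mem_nhds (chartGL_center (k := k) W).1] with y hy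
    exact (chartGL_rep W hy).2

theorem isAnalyticSubmersion_O : IsAnalyticSubmersion (E := ModelO n k)
    (fun (V : Matrix.orthogonalGroup (Fin n) ℝ) i j => V.1 i j)
    (QuotientGroup.mk : Matrix.orthogonalGroup (Fin n) ℝ → OQuot n k) := by
  intro V
  -- The quotient map is extended off `O_n` by orthonormalising nearby invertible matrices first; on
  -- `O_n` this changes nothing.
  refine ⟨⟨fun A => gramSchmidtMap n k (QuotientGroup.mk (toGL A)),
    (contMDiff_gramSchmidtMap _).comp _ (contMDiffAt_mk_toGL (Unitary.toUnits V)),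
    Filter.Eventually.of_forall fun V' => ?_⟩,
    fun x => V * gramSchmidtGL (toGL (glue (chartO V x, 0))), repO_center V,
    entriesAnalyticAt_iff.1 (entriesAnalyticAt_repO V), ?_⟩
  · exact (congrArg (fun W => gramSchmidtMap n k (QuotientGroup.mk W))
      (toGL_unit (Unitary.toUnits V'))).trans (mk_gs_toUnits V')
  · filter_upwards [(chartO V).open_source.mem_nhds (chartO_center (k := k) V).1] with x hx
    exact chartO_rep V hx

end maps

/-! ### The tangent bundle -/

section tangent

variable {n k : ℕ}

/-- The matrix whose upper right block is the transpose of the given array, all other blocks being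
zero. -/
def upperBlock (n k : ℕ) : ModelO n k →ₗ[ℝ] Matrix (Fin n) (Fin n) ℝ where
  toFun v := Matrix.of fun i j =>
    if h : i.1 < k ∧ ¬ j.1 < k then v ⟨j, h.2⟩ ⟨i, h.1⟩ else 0
  map_add' v w := by
    ext i j
    simp only [Matrix.of_apply, Matrix.add_apply]
    split_ifs <;> simp
  map_smul' c v := by
    ext i j
    simp only [Matrix.of_apply, Matrix.smul_apply]
    split_ifs <;> simp

theorem blk_upperBlock (v : ModelO n k) : blkA k (upperBlock n k v) = 0 ∧
    blkB k (upperBlock n k v) = Matrix.transpose v ∧ blkC k (upperBlock n k v) = 0 ∧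
    blkD k (upperBlock n k v) = 0 := by
  refine ⟨?_, ?_, ?_, ?_⟩ <;> ext ⟨i, hi⟩ ⟨j, hj⟩
  · simp [blkA, upperBlock, hi, hj]
  · exact dif_pos ⟨hi, hj⟩
  · simp [blkC, upperBlock, hi]
  · simp [blkD, upperBlock, hi]

/-- The relations defining the fibre space at the base point: `P N = N` kills the lower rows and `N
P = 0` the left columns, so only the upper right block survives. -/
theorem upperBlock_blkB {N : Matrix (Fin n) (Fin n) ℝ} (h1 : diagProj n k * N = N)
    (h2 : N * diagProj n k = 0) : upperBlock n k (blkB k N)ᵀ = N := by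
  have h3 := congrArg (blkC k) h1
  have h4 := congrArg (blkD k) h1
  have h5 := congrArg (blkA k) h2
  rw [blkC_mul, blkC_diagProj, blkD_diagProj, Matrix.zero_mul, Matrix.zero_mul, add_zero] at h3
  rw [blkD_mul, blkC_diagProj, blkD_diagProj, Matrix.zero_mul, Matrix.zero_mul, add_zero] at h4
  rw [blkA_mul, blkA_diagProj, blkC_diagProj, Matrix.mul_one, Matrix.mul_zero, add_zero] at h5
  obtain ⟨k1, k2, k3, k4⟩ := blk_upperBlock (blkB k N)ᵀ
  exact blk_ext (k := k) (k1.trans h5.symm) k2 (k3.trans h3) (k4.trans h4)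

theorem diagProj_mul_upperBlock (v : ModelO n k) :
    diagProj n k * upperBlock n k v = upperBlock n k v := by
  obtain ⟨k1, k2, k3, k4⟩ := blk_upperBlock v
  apply blk_ext (k := k) <;>
    simp [blkA_mul, blkB_mul, blkC_mul, blkD_mul, k1, k3, k4, blkA_diagProj, blkB_diagProj,
      blkC_diagProj, blkD_diagProj]

theorem upperBlock_mul_diagProj (v : ModelO n k) :
    upperBlock n k v * diagProj n k = 0 := by
  obtain ⟨k1, k2, k3, k4⟩ := blk_upperBlock v
  apply blk_ext (k := k)
  · rw [blkA_mul, k1, blkC_diagProj, Matrix.zero_mul, Matrix.mul_zero, add_zero]; rfl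
  · rw [blkB_mul, k1, blkD_diagProj, Matrix.zero_mul, Matrix.mul_zero, add_zero]; rfl
  · rw [blkC_mul, k3, blkC_diagProj, Matrix.zero_mul, Matrix.mul_zero, add_zero]; rfl
  · rw [blkD_mul, k3, blkD_diagProj, Matrix.zero_mul, Matrix.mul_zero, add_zero]; rfl

/-- Used twice: to recognise the chart change of tangent vectors as a conjugation of matrices, and
to solve for the tangent coordinates when `Φ` is inverted. -/
theorem blkB_sandwich (X Y : Matrix (Fin n) (Fin n) ℝ) (v : ModelO n k) :
    blkB k (X * upperBlock n k v * Y) = blkA k X * Matrix.transpose v * blkD k Y := by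
  obtain ⟨k1, k2, k3, k4⟩ := blk_upperBlock v
  rw [blkB_mul, blkA_mul, blkB_mul, k1, k2, k3, k4]
  simp only [Matrix.mul_zero, add_zero, Matrix.zero_mul, zero_add]

theorem orthProj_out (x : OQuot n k) : orthProj n k x =
    (Quotient.out x).1 * diagProj n k * (Quotient.out x).1ᵀ := by
  conv_lhs => rw [← QuotientGroup.out_eq' x]
  rfl

/-- The model space, identified with the linear space of matrices belonging to the fibre over `x`,
by means of the chosen orthogonal matrix representing `x`. -/
noncomputable def modelEquiv (x : OQuot n k) : ModelO n k ≃ₗ[ℝ] fibreSpace n k x where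
  toFun v := ⟨(Quotient.out x).1 * upperBlock n k v * (Quotient.out x).1ᵀ, by
    have h := transpose_mul_orthogonal (Quotient.out x)
    rw [mem_fibreSpace, orthProj_out]
    generalize (Quotient.out x).1 = V at h
    constructor
    · calc V * diagProj n k * Vᵀ * (V * upperBlock n k v * Vᵀ)
          = V * (diagProj n k * ((Vᵀ * V) * upperBlock n k v)) * Vᵀ := by noncomm_ring
        _ = _ := by rw [h, Matrix.one_mul, diagProj_mul_upperBlock]
    · calc V * upperBlock n k v * Vᵀ * (V * diagProj n k * Vᵀ)
          = V * (upperBlock n k v * ((Vᵀ * V) * diagProj n k)) * Vᵀ := by noncomm_ring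
        _ = _ := by rw [h, Matrix.one_mul, upperBlock_mul_diagProj, Matrix.mul_zero,
                      Matrix.zero_mul]⟩
  map_add' v w := Subtype.ext (by simp [Matrix.mul_add, Matrix.add_mul])
  map_smul' c v := Subtype.ext (by simp)
  invFun N := (blkB k ((Quotient.out x).1ᵀ * N.1 * (Quotient.out x).1))ᵀ
  left_inv v := by
    have h := transpose_mul_orthogonal (Quotient.out x)
    set V := (Quotient.out x).1
    have e : Vᵀ * (V * upperBlock n k v * Vᵀ) * V = upperBlock n k v := by
      calc Vᵀ * (V * upperBlock n k v * Vᵀ) * V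
          = (Vᵀ * V) * upperBlock n k v * (Vᵀ * V) := by noncomm_ring
        _ = _ := by rw [h, Matrix.one_mul, Matrix.mul_one]
    show (blkB k (Vᵀ * (V * upperBlock n k v * Vᵀ) * V))ᵀ = v
    rw [e, (blk_upperBlock v).2.1]
    rfl
  right_inv N := by
    apply Subtype.ext
    have h := transpose_mul_orthogonal (Quotient.out x)
    have h' := orthogonal_mul_transpose (Quotient.out x)
    obtain ⟨h1, h2⟩ := mem_fibreSpace.1 N.2
    rw [orthProj_out] at h1 h2
    show (Quotient.out x).1 * upperBlock n k (blkB k _)ᵀ * _ = _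
    generalize (Quotient.out x).1 = V at *
    generalize N.1 = N at *
    rw [upperBlock_blkB]
    · calc V * (Vᵀ * N * V) * Vᵀ = (V * Vᵀ) * N * (V * Vᵀ) := by noncomm_ring
        _ = N := by rw [h', Matrix.one_mul, Matrix.mul_one]
    · calc diagProj n k * (Vᵀ * N * V) = (Vᵀ * V) * (diagProj n k * (Vᵀ * N * V)) := by
            rw [h, Matrix.one_mul]
        _ = Vᵀ * (V * diagProj n k * Vᵀ * N) * V := by noncomm_ring
        _ = _ := by rw [h1]
    · calc Vᵀ * N * V * diagProj n k = Vᵀ * N * V * diagProj n k * (Vᵀ * V) := by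
            rw [h, Matrix.mul_one]
        _ = Vᵀ * (N * (V * diagProj n k * Vᵀ)) * V := by noncomm_ring
        _ = 0 := by rw [h2, Matrix.mul_zero, Matrix.zero_mul]

theorem coe_modelEquiv (x : OQuot n k) (v : ModelO n k) :
    (modelEquiv x v : Matrix (Fin n) (Fin n) ℝ) =
      (Quotient.out x).1 * upperBlock n k v * (Quotient.out x).1ᵀ := rfl

/-- The coordinate change of the charts of `O_n / (O_k × O_{n-k})`. -/
theorem chartO_symm_trans (V V' : Matrix.orthogonalGroup (Fin n) ℝ) (T : ModelO n k) :
    chartO (k := k) V' ((chartO V).symm T) = slopeLow k ((V'⁻¹ * V).1 * glue (T, 0)) := by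
  have h : chartO (k := k) V' ((chartO V).symm T) =
      slopeLow k (V'⁻¹ * ((V⁻¹)⁻¹ * gramSchmidtGL (toGL (glue (T, 0))))).1 := rfl
  have e : (V'⁻¹ * ((V⁻¹)⁻¹ * gramSchmidtGL (toGL (glue (T, 0))))).1 =
      (V'⁻¹ * V).1 * glue (T, 0) *
        (((Unitary.toUnits (gramSchmidtGL (toGL (glue (T, 0)))))⁻¹ * toGL (glue (T, 0)))⁻¹).1 := by
    rw [inv_inv, ← mul_assoc]
    show (V'⁻¹ * V).1 * (gramSchmidtGL (toGL (glue (T, 0)))).1 = _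
    rw [gs_eq, toGL_val (det_glue_zero T), Matrix.mul_assoc]
  rw [h, e, (low_mul _ _ (IsBlockUpper.inv _ (isBlockUpper_gs k _))).1]

/-- The derivative `w` at `0`, in the direction `v`, of the fractional linear map
`T ↦ (C + D T) (A + B T)⁻¹`. -/
theorem fderiv_slopeLow_mul_glue (G : Matrix (Fin n) (Fin n) ℝ) (hA : (blkA k G).det ≠ 0)
    (v : ModelO n k) :
    Matrix.of (fderiv ℝ (fun T : ModelO n k => slopeLow k (G * glue (T, 0))) 0 v) * blkA k G +
      blkC k G * (blkA k G)⁻¹ * (blkB k G * Matrix.of v) =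
      blkD k G * Matrix.of v := by
  set s : ModelO n k → ModelO n k := fun T => slopeLow k (G * glue (T, 0)) with hs
  have e0 : G * glue ((0, 0) : ModelGL n k) = G := by
    rw [show glue ((0, 0) : ModelGL n k) = 1 from glue_zero, Matrix.mul_one]
  have eA : ∀ T : ModelO n k, blkA k (G * glue (T, 0)) =
      blkA k G + blkB k G * Matrix.of T := by
    intro T
    rw [blkA_mul, blkA_glue, blkC_glue, Matrix.mul_one]
    rfl
  have eC : ∀ T : ModelO n k, blkC k (G * glue (T, 0)) =
      blkC k G + blkD k G * Matrix.of T := by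
    intro T
    rw [blkC_mul, blkA_glue, blkC_glue, Matrix.mul_one]
    rfl
  have hX : ∀ i j, ContDiffAt ℝ ω (fun T : ModelO n k => (G * glue (T, 0)) i j) 0 := fun i j =>
    ((contDiff_mul_glue _ i j).comp (contDiff_id.prodMk contDiff_const)).contDiffAt
  have hsd : DifferentiableAt ℝ s 0 := by
    have hA0 : (blkA k (G * glue ((0, 0) : ModelGL n k))).det ≠ 0 := by rwa [e0]
    exact (contDiffAt_slopeLow hX hA0).differentiableAt (by simp)
  have hcurve : HasDerivAt (fun t : ℝ => s (t • v)) (fderiv ℝ s 0 v) 0 := by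
    have h1 : HasDerivAt (fun t : ℝ => t • v) v 0 := by
      simpa using (hasDerivAt_id (0 : ℝ)).smul_const v
    have h2 : HasFDerivAt s (fderiv ℝ s 0) ((0 : ℝ) • v) := by
      rw [zero_smul]; exact hsd.hasFDerivAt
    exact h2.comp_hasDerivAt 0 h1
  have hentry : ∀ i j, HasDerivAt (fun t : ℝ => s (t • v) i j) (fderiv ℝ s 0 v i j) 0 :=
    fun i j => hasDerivAt_pi.1 (hasDerivAt_pi.1 hcurve i) j
  have hev : ∀ᶠ t : ℝ in 𝓝 0, (blkA k (G * glue (t • v, 0))).det ≠ 0 := by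
    have hc : Continuous fun t : ℝ => (blkA k (G * glue (t • v, 0))).det := by
      refine (continuous_blkA.comp ?_).matrix_det
      refine continuous_const.matrix_mul (continuous_glue.comp ?_)
      fun_prop
    refine hc.continuousAt.eventually_ne ?_
    rwa [zero_smul, e0]
  have hs0 : s 0 = blkC k G * (blkA k G)⁻¹ := by
    show blkC k (G * glue ((0, 0) : ModelGL n k)) * (blkA k (G * glue ((0, 0) : ModelGL n k)))⁻¹ = _
    rw [e0]
  ext i j
  have hL : HasDerivAt (fun t : ℝ => ∑ a, s (t • v) i a *
      (blkA k G a j + t * (blkB k G * Matrix.of v) a j))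
      (∑ a, (fderiv ℝ s 0 v i a * blkA k G a j + s 0 i a *
        (blkB k G * Matrix.of v) a j)) 0 := by
    refine HasDerivAt.fun_sum fun a _ => ?_
    have h1 : HasDerivAt (fun t : ℝ => blkA k G a j +
        t * (blkB k G * Matrix.of v) a j)
        ((blkB k G * Matrix.of v) a j) 0 := by
      simpa using ((hasDerivAt_id (0 : ℝ)).mul_const
        ((blkB k G * Matrix.of v) a j)).const_add (blkA k G a j)
    have h2 := (hentry i a).fun_mul h1
    rw [zero_smul, zero_mul, add_zero] at h2
    exact h2
  have hR : HasDerivAt (fun t : ℝ => blkC k G i j +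
      t * (blkD k G * Matrix.of v) i j)
      ((blkD k G * Matrix.of v) i j) 0 := by
    simpa using ((hasDerivAt_id (0 : ℝ)).mul_const
      ((blkD k G * Matrix.of v) i j)).const_add (blkC k G i j)
  -- The denominator is cleared before differentiating: for small `t`, `s(tv) (A + t B v) = C + t D
  -- v`. The product rule on the left then replaces the derivative of a matrix inverse.
  have heq : (fun t : ℝ => ∑ a, s (t • v) i a *
      (blkA k G a j + t * (blkB k G * Matrix.of v) a j)) =ᶠ[𝓝 0]
      fun t : ℝ => blkC k G i j +
        t * (blkD k G * Matrix.of v) i j := by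
    filter_upwards [hev] with t ht
    have h1 : Matrix.of (s (t • v)) * blkA k (G * glue (t • v, 0)) =
        blkC k (G * glue (t • v, 0)) := by
      show Matrix.of (slopeLow k (G * glue (t • v, 0))) * _ = _
      generalize G * glue (t • v, 0) = M at ht
      show blkC k M * (blkA k M)⁻¹ * blkA k M = _
      rw [Matrix.mul_assoc, Matrix.nonsing_inv_mul _ (isUnit_iff_ne_zero.2 ht), Matrix.mul_one]
    rw [eA, eC] at h1
    have h2 := congrFun (congrFun h1 i) j
    have e1 : ∀ {l : Type} (X : Matrix l (HighIdx n k) ℝ),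
        X * Matrix.of (t • v) = t • (X * Matrix.of v) := fun X => Matrix.mul_smul X t (Matrix.of v)
    rw [e1, e1] at h2
    exact h2
  have := hL.unique (hR.congr_of_eventuallyEq heq)
  rw [Finset.sum_add_distrib] at this
  rw [← hs0, ← this]
  rfl

/-- The tangent coordinates with respect to the preferred chart at `x₀`, as seen in the matrices. -/
theorem conj_modelEquiv (x₀ x : OQuot n k) (v : ModelO n k)
    (hA : (blkA k ((Quotient.out x₀).1ᵀ * orthProj n k x * (Quotient.out x₀).1)).det ≠ 0) :
    (Quotient.out x₀).1ᵀ * (modelEquiv x v).1 * (Quotient.out x₀).1 =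
      (Quotient.out x₀).1ᵀ * orthProj n k x * (Quotient.out x₀).1 *
        upperBlock n k (trivializationAt (ModelO n k)
          (TangentSpace 𝓘(ℝ, ModelO n k) (M := OQuot n k)) x₀ ⟨x, v⟩).2 *
        (1 - (Quotient.out x₀).1ᵀ * orthProj n k x * (Quotient.out x₀).1) := by
  set V₀ := Quotient.out x₀ with hV₀
  set V := Quotient.out x with hV
  set w : ModelO n k := (trivializationAt (ModelO n k)
          (TangentSpace 𝓘(ℝ, ModelO n k) (M := OQuot n k)) x₀ ⟨x, v⟩).2 with hw
  set G : Matrix (Fin n) (Fin n) ℝ := (V₀⁻¹ * V).1 with hG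
  have hG' : G = V₀.1ᵀ * V.1 := rfl
  have hGG : Gᵀ * G = 1 := transpose_mul_orthogonal (V₀⁻¹ * V)
  have hGG' : G * Gᵀ = 1 := orthogonal_mul_transpose (V₀⁻¹ * V)
  have eR : V₀.1ᵀ * orthProj n k x * V₀.1 = G * diagProj n k * Gᵀ := by
    rw [orthProj_out, hG', Matrix.transpose_mul, Matrix.transpose_transpose]
    simp only [Matrix.mul_assoc]
    rfl
  have eN : V₀.1ᵀ * (modelEquiv x v).1 * V₀.1 = G * upperBlock n k v * Gᵀ := by
    rw [coe_modelEquiv, hG', Matrix.transpose_mul, Matrix.transpose_transpose]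
    simp only [Matrix.mul_assoc]
    rfl
  -- The coordinates of a tangent vector in the trivialisation at `x₀` come from the derivative of
  -- the change from the preferred chart at `x` to that at `x₀`. It is taken at `0` because the
  -- preferred chart at `x` is centred there.
  have hwe : w = fderiv ℝ (fun T : ModelO n k => slopeLow k (G * glue (T, 0))) 0 v := by
    have h0 : chartAt (ModelO n k) x x = 0 := by
      have := (chartO_center (k := k) V).2
      rwa [show (QuotientGroup.mk V : OQuot n k) = x from QuotientGroup.out_eq' x] at this
    have h1 : (fun T : ModelO n k => slopeLow k (G * glue (T, 0))) =
        (chartAt (ModelO n k) x₀ ∘ (chartAt (ModelO n k) x).symm) :=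
      funext fun T => (chartO_symm_trans V V₀ T).symm
    rw [h1, ← h0, hw, TangentBundle.trivializationAt_apply]
    simp [fderivWithin_univ]
  have hA' : (blkA k G).det ≠ 0 := by
    rw [eR] at hA
    exact (slopeLow_conj hA).1
  have key := fderiv_slopeLow_mul_glue G hA' v
  rw [← hwe] at key
  rw [eR, eN]
  have h1 : (blkB k G)ᵀ * blkB k G + (blkD k G)ᵀ * blkD k G = 1 := by
    have := congrArg (blkD k) hGG
    rwa [blkD_mul, blk_one.2.2.2] at this
  have h2 : (blkB k G)ᵀ * blkA k G + (blkD k G)ᵀ * blkC k G = 0 := by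
    have := congrArg (blkC k) hGG
    rwa [blkC_mul, blk_one.2.2.1] at this
  -- Multiply `w A + C A⁻¹ B v = D v` by `Dᵀ`. Since `Dᵀ C = -Bᵀ A`, the second term becomes `-Bᵀ B
  -- v`, and `Bᵀ B + Dᵀ D = 1` leaves `Dᵀ w A = v`.
  have hv' : Matrix.of v = (blkD k G)ᵀ * (Matrix.of w * blkA k G) := by
    have h3 : (blkD k G)ᵀ * (blkC k G * (blkA k G)⁻¹ * (blkB k G * Matrix.of v)) =
        -((blkB k G)ᵀ * blkB k G * Matrix.of v) := by
      rw [← Matrix.mul_assoc, ← Matrix.mul_assoc, ← Matrix.mul_assoc (blkD k G)ᵀ,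
        eq_neg_of_add_eq_zero_right h2, Matrix.neg_mul, Matrix.mul_assoc (blkB k G)ᵀ (blkA k G),
        Matrix.mul_nonsing_inv _ (isUnit_iff_ne_zero.2 hA'), Matrix.mul_one, Matrix.neg_mul,
        Matrix.neg_mul]
    rw [eq_sub_of_add_eq key, Matrix.mul_sub, h3, sub_neg_eq_add, ← Matrix.mul_assoc,
      ← Matrix.add_mul, add_comm, h1, Matrix.one_mul]
  have hv : Matrix.transpose v = blkA k Gᵀ * Matrix.transpose w * blkD k G := by
    refine (congrArg Matrix.transpose hv').trans ?_
    rw [Matrix.transpose_mul, Matrix.transpose_mul, Matrix.transpose_transpose]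
    rfl
  -- After transposition, `vᵀ = Aᵀ wᵀ D` is the upper right block of `Gᵀ U(w) G`, with `U` standing
  -- for `upperBlock`; multiplying by `P` on the left and by `1 - P` on the right isolates this
  -- block.
  have e1 : upperBlock n k v = diagProj n k * (Gᵀ * upperBlock n k w * G) * (1 - diagProj n k) := by
    have h3 : blkB k (diagProj n k * (Gᵀ * upperBlock n k w * G) * (1 - diagProj n k)) =
        Matrix.transpose v := by
      rw [hv, ← blkB_sandwich]
      simp [blkA_mul (diagProj n k), blkB_mul (diagProj n k), blkB_mul (diagProj n k * _), blk_sub,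
        blk_one, blkA_diagProj, blkB_diagProj, blkD_diagProj]
    rw [← upperBlock_blkB (N := diagProj n k * (Gᵀ * upperBlock n k w * G) * (1 - diagProj n k)),
      h3]
    · rfl
    · rw [Matrix.mul_assoc, ← Matrix.mul_assoc, diagProj_mul_self]
    · rw [Matrix.mul_assoc, Matrix.sub_mul, diagProj_mul_self, Matrix.one_mul, sub_self,
        Matrix.mul_zero]
  rw [e1]
  calc G * (diagProj n k * (Gᵀ * upperBlock n k w * G) * (1 - diagProj n k)) * Gᵀ
      = G * diagProj n k * Gᵀ * upperBlock n k w * (G * Gᵀ - G * diagProj n k * Gᵀ) := by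
        noncomm_ring
    _ = _ := by rw [hGG']

end tangent

/-! ### The linear structure of the fibres, the map `Φ` and the vector bundle -/

section bundle

variable {n k : ℕ}

/-- Transport along `fibreEquiv` makes `Q ↦ Q - R` linear by construction, with the orthogonal
projection `R` as zero vector. -/
noncomputable instance fibreAddCommGroup (x : OQuot n k) :
    AddCommGroup (gramSchmidtMap n k ⁻¹' {x}) := (fibreEquiv x).addCommGroup

noncomputable instance fibreModule (x : OQuot n k) :
    Module ℝ (gramSchmidtMap n k ⁻¹' {x}) := (fibreEquiv x).module ℝ

/-- The fibre over `x`, linearly identified with a linear space of matrices. -/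
noncomputable def fibreLinearEquiv (x : OQuot n k) :
    gramSchmidtMap n k ⁻¹' {x} ≃ₗ[ℝ] fibreSpace n k x := (fibreEquiv x).linearEquiv ℝ

theorem coe_fibreLinearEquiv (x : OQuot n k) (y : gramSchmidtMap n k ⁻¹' {x}) :
    (fibreLinearEquiv x y : Matrix (Fin n) (Fin n) ℝ) = idem n k y.1 - orthProj n k x := rfl

theorem isLinearMap_idem_sub (x : OQuot n k) : IsLinearMap ℝ
    fun a : gramSchmidtMap n k ⁻¹' {x} => idem n k a.1 - orthProj n k x :=
  ((fibreSpace n k x).subtype ∘ₗ (fibreLinearEquiv x).toLinearMap).isLinear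

/-- The tangent space at `x`, linearly identified with the fibre over `x`. -/
noncomputable def tangentFibreEquiv (x : OQuot n k) :
    TangentSpace 𝓘(ℝ, ModelO n k) x ≃ₗ[ℝ] gramSchmidtMap n k ⁻¹' {x} :=
  -- The tangent space at `x` is the model space as seen in the preferred chart at `x`. That chart
  -- is built from `Quotient.out x`, the representative used by `modelEquiv`, so the two choices
  -- match.
  (modelEquiv x).trans (fibreLinearEquiv x).symm

theorem idem_tangentFibreEquiv (x : OQuot n k) (v : TangentSpace 𝓘(ℝ, ModelO n k) x) :
    idem n k (tangentFibreEquiv x v).1 = orthProj n k x + (modelEquiv x v).1 := by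
  have h : fibreLinearEquiv x (tangentFibreEquiv x v) = modelEquiv x v :=
    (fibreLinearEquiv x).apply_symm_apply _
  rw [← h, coe_fibreLinearEquiv, add_sub_cancel]

/-- The base points `υ a` and `x` are only propositionally equal, so the vectors over them live in
different types; the comparison is made in the total space. -/
theorem mk_tangentFibreEquiv_symm (x : OQuot n k) (a : gramSchmidtMap n k ⁻¹' {x}) :
    (⟨gramSchmidtMap n k a.1, (tangentFibreEquiv (gramSchmidtMap n k a.1)).symm ⟨a.1, rfl⟩⟩ :
      TangentBundle 𝓘(ℝ, ModelO n k) (OQuot n k)) = ⟨x, (tangentFibreEquiv x).symm a⟩ := by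
  obtain ⟨y, rfl⟩ := a
  rfl

/-- The total space of the tangent bundle, identified fibrewise with the total space of the
Gram-Schmidt bundle. -/
noncomputable def tangentEquiv (n k : ℕ) :
    TangentBundle 𝓘(ℝ, ModelO n k) (OQuot n k) ≃ GLQuot n k where
  toFun p := (tangentFibreEquiv p.proj p.2).1
  invFun y := ⟨gramSchmidtMap n k y, (tangentFibreEquiv (gramSchmidtMap n k y)).symm ⟨y, rfl⟩⟩
  left_inv := by
    rintro ⟨x, v⟩
    exact (mk_tangentFibreEquiv_symm x (tangentFibreEquiv x v)).trans
      (congrArg _ ((tangentFibreEquiv x).symm_apply_apply v))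
  right_inv y := by
    simp

theorem gramSchmidtMap_tangentEquiv (p : TangentBundle 𝓘(ℝ, ModelO n k) (OQuot n k)) :
    gramSchmidtMap n k (tangentEquiv n k p) = p.proj :=
  (tangentFibreEquiv p.proj p.2).2

theorem idem_tangentEquiv (p : TangentBundle 𝓘(ℝ, ModelO n k) (OQuot n k)) :
    idem n k (tangentEquiv n k p) = orthProj n k p.proj + (modelEquiv p.proj p.2).1 :=
  idem_tangentFibreEquiv _ _

theorem conj_orthProj_out (x : OQuot n k) :
    (Quotient.out x).1ᵀ * orthProj n k x * (Quotient.out x).1 = diagProj n k := by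
  have := conj_orthProj_mk (k := k) (Quotient.out x)
  rwa [show (QuotientGroup.mk (Quotient.out x) : OQuot n k) = x from QuotientGroup.out_eq' x]
    at this

theorem det_blkA_conj_out (x : OQuot n k) :
    (blkA k ((Quotient.out x).1ᵀ * orthProj n k x * (Quotient.out x).1)).det ≠ 0 := by
  rw [conj_orthProj_out, blkA_diagProj, Matrix.det_one]
  exact one_ne_zero

theorem det_blkD_conj_out (x : OQuot n k) :
    (blkD k (1 - (Quotient.out x).1ᵀ * orthProj n k x * (Quotient.out x).1)).det ≠ 0 := by
  rw [conj_orthProj_out, (blk_sub _ _).2.2.2, blk_one.2.2.2, blkD_diagProj, sub_zero,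
    Matrix.det_one]
  exact one_ne_zero

section families

variable {E H M : Type} [NormedAddCommGroup E] [NormedSpace ℝ E] [TopologicalSpace H]
  [TopologicalSpace M] [ChartedSpace H M] {I : ModelWithCorners ℝ E H} {a : M}

theorem EntriesAnalyticAt.upperBlock {f : M → ModelO n k}
    (hf : ContMDiffAt I 𝓘(ℝ, ModelO n k) ω f a) :
    EntriesAnalyticAt I (fun z => upperBlock n k (f z)) a := by
  have hf' := entriesAnalyticAt_iff (f := f).2 hf
  intro i j
  show ContMDiffAt I 𝓘(ℝ, ℝ) ω
    (fun z => if h : i.1 < k ∧ ¬ j.1 < k then f z ⟨j, h.2⟩ ⟨i, h.1⟩ else 0) a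
  split_ifs
  · exact hf' _ _
  · exact contMDiffAt_const

theorem entriesAnalyticAt_orthProj_comp {f : M → OQuot n k}
    (hf : ContMDiffAt I 𝓘(ℝ, ModelO n k) ω f a) :
    EntriesAnalyticAt I (fun z => orthProj n k (f z)) a :=
  fun i j => (entriesAnalyticAt_orthProj (f a) i j).comp a hf

end families

/-- The idempotent of `Φ(x, v)` is `R + N`. The definition of `N` involves `Quotient.out x`, which
need not vary continuously with `x`. Near a fixed base point, `conj_modelEquiv` rewrites `N` through
the analytic data `R` and `w` and the constant matrix `V`. -/
theorem contMDiff_tangentEquiv :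
    ContMDiff 𝓘(ℝ, ModelO n k).tangent 𝓘(ℝ, ModelGL n k) ω (tangentEquiv n k) := by
  intro p₀
  apply contMDiffAt_of_idem
  obtain ⟨hproj, hw⟩ := Bundle.contMDiffAt_totalSpace.1
    (contMDiffAt_id (I := 𝓘(ℝ, ModelO n k).tangent) (n := ω) (x := p₀))
  simp only [id] at hproj hw
  set V := Quotient.out p₀.proj with hV
  have hR := entriesAnalyticAt_orthProj_comp hproj
  have hc : ∀ A : Matrix (Fin n) (Fin n) ℝ,
      EntriesAnalyticAt 𝓘(ℝ, ModelO n k).tangent (fun _ => A) p₀ := entriesAnalyticAt_const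
  have hR' := ((hc V.1ᵀ).mul hR).mul (hc V.1)
  have hN := (hR'.mul (EntriesAnalyticAt.upperBlock hw)).mul ((hc 1).sub hR')
  refine (hR.add (((hc V.1).mul hN).mul (hc V.1ᵀ))).congr ?_
  filter_upwards [hR'.blkA.eventually_det_ne_zero (det_blkA_conj_out (k := k) p₀.proj)] with p hp
  have h := conj_modelEquiv p₀.proj p.proj p.2 hp
  rw [idem_tangentEquiv]
  congr 1
  refine Eq.trans ?_ (congrArg (fun X => V.1 * X * V.1ᵀ) h)
  show _ = V.1 * (V.1ᵀ * (modelEquiv p.proj p.2).1 * V.1) * V.1ᵀ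
  calc (modelEquiv p.proj p.2).1 = (V.1 * V.1ᵀ) * (modelEquiv p.proj p.2).1 * (V.1 * V.1ᵀ) := by
        rw [orthogonal_mul_transpose, Matrix.one_mul, Matrix.mul_one]
    _ = _ := by noncomm_ring

/-- The tangent coordinates `w` are recovered by solving. With `R' = Vᵀ R V`, the upper right block
of `Vᵀ (Q - R) V` is the block `A` of `R'`, times `wᵀ`, times the block `D` of `1 - R'`. Both outer
factors are identity matrices at the centre, hence invertible nearby. -/
theorem contMDiff_tangentEquiv_symm :
    ContMDiff 𝓘(ℝ, ModelGL n k) 𝓘(ℝ, ModelO n k).tangent ω (tangentEquiv n k).symm := by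
  intro y₀
  refine Bundle.contMDiffAt_totalSpace.2 ⟨contMDiff_gramSchmidtMap y₀, ?_⟩
  set V := Quotient.out (gramSchmidtMap n k y₀) with hV
  have hR := entriesAnalyticAt_orthProj_comp (contMDiff_gramSchmidtMap (n := n) (k := k) y₀)
  have hQ := entriesAnalyticAt_idem y₀
  have hc : ∀ A : Matrix (Fin n) (Fin n) ℝ,
      EntriesAnalyticAt 𝓘(ℝ, ModelGL n k) (fun _ : GLQuot n k => A) y₀ := entriesAnalyticAt_const
  have hR' := ((hc V.1ᵀ).mul hR).mul (hc V.1)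
  have hN := ((hc V.1ᵀ).mul (hQ.sub hR)).mul (hc V.1)
  have hA : (blkA k (V.1ᵀ * orthProj n k (gramSchmidtMap n k y₀) * V.1)).det ≠ 0 :=
    det_blkA_conj_out _
  have hD : (blkD k (1 - V.1ᵀ * orthProj n k (gramSchmidtMap n k y₀) * V.1)).det ≠ 0 :=
    det_blkD_conj_out _
  have hD' := ((hc 1).sub hR').blkD (k := k)
  have hA' := hR'.blkA (k := k)
  have hw := (((hA'.inv hA).mul hN.blkB).mul (hD'.inv hD)).transpose
  refine (entriesAnalyticAt_iff.1 hw).congr_of_eventuallyEq ?_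
  filter_upwards [hA'.eventually_det_ne_zero hA, hD'.eventually_det_ne_zero hD] with y h1 h2
  set p := (tangentEquiv n k).symm y with hp
  have h := conj_modelEquiv (gramSchmidtMap n k y₀) (gramSchmidtMap n k y) p.2 h1
  have e : (modelEquiv (gramSchmidtMap n k y) p.2).1 =
      idem n k y - orthProj n k (gramSchmidtMap n k y) := by
    have := idem_tangentEquiv p
    rw [hp, Equiv.apply_symm_apply] at this
    exact eq_sub_of_add_eq' this.symm
  rw [e] at h
  have hB := congrArg (blkB k) h
  rw [blkB_sandwich] at hB
  have hB' := congrArg Matrix.transpose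
    (congrArg (fun X => (blkA k (V.1ᵀ * orthProj n k (gramSchmidtMap n k y) * V.1))⁻¹ * X *
      (blkD k (1 - V.1ᵀ * orthProj n k (gramSchmidtMap n k y) * V.1))⁻¹) hB)
  refine Eq.trans ?_ hB'.symm
  rw [← Matrix.mul_assoc, ← Matrix.mul_assoc, Matrix.nonsing_inv_mul _ (isUnit_iff_ne_zero.2 h1),
    Matrix.one_mul, Matrix.mul_assoc, Matrix.mul_nonsing_inv _ (isUnit_iff_ne_zero.2 h2),
    Matrix.mul_one]
  rfl

/-- The bi-analytic identification of the tangent bundle with the Gram-Schmidt bundle. -/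
noncomputable def tangentDiffeomorph (n k : ℕ) :
    Diffeomorph 𝓘(ℝ, ModelO n k).tangent 𝓘(ℝ, ModelGL n k)
      (TangentBundle 𝓘(ℝ, ModelO n k) (OQuot n k)) (GLQuot n k) ω where
  toEquiv := tangentEquiv n k
  contMDiff_toFun := contMDiff_tangentEquiv
  contMDiff_invFun := contMDiff_tangentEquiv_symm

/-- The tangent bundle trivialization at `b`, transported to the Gram-Schmidt bundle. -/
noncomputable def gramSchmidtTrivialization (b : OQuot n k) :
    Bundle.Trivialization (ModelO n k) (gramSchmidtMap n k) where
  toOpenPartialHomeomorph := (tangentDiffeomorph n k).symm.toHomeomorph.transOpenPartialHomeomorph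
    (trivializationAt (ModelO n k)
      (TangentSpace 𝓘(ℝ, ModelO n k) (M := OQuot n k)) b).toOpenPartialHomeomorph
  baseSet := (trivializationAt (ModelO n k)
    (TangentSpace 𝓘(ℝ, ModelO n k) (M := OQuot n k)) b).baseSet
  open_baseSet := (trivializationAt (ModelO n k)
    (TangentSpace 𝓘(ℝ, ModelO n k) (M := OQuot n k)) b).open_baseSet
  source_eq := by
    ext y
    exact (trivializationAt (ModelO n k)
      (TangentSpace 𝓘(ℝ, ModelO n k) (M := OQuot n k)) b).mem_source
  target_eq := (trivializationAt (ModelO n k)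
    (TangentSpace 𝓘(ℝ, ModelO n k) (M := OQuot n k)) b).target_eq
  proj_toFun y hy := (trivializationAt (ModelO n k)
    (TangentSpace 𝓘(ℝ, ModelO n k) (M := OQuot n k)) b).proj_toFun _ hy

/-- The trivialisations are those of the tangent bundle composed with `Φ⁻¹`. Analyticity and
linearity carry over because `Φ` is bi-analytic and fibrewise linear, and the coordinate changes are
those of the tangent bundle, as `Φ⁻¹ ∘ Φ` cancels. -/
theorem isAnalyticVectorBundle_gramSchmidtMap :
    IsAnalyticVectorBundle (ModelO n k) 𝓘(ℝ, ModelO n k) 𝓘(ℝ, ModelGL n k)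
      (gramSchmidtMap n k) where
  isManifold_base := inferInstance
  isManifold_total := inferInstance
  t2_base := t2Space_OQuot
  t2_total := t2Space_GLQuot
  surjective := gramSchmidtMap_surjective
  analytic_proj := contMDiff_gramSchmidtMap
  exists_trivializations := by
    refine ⟨gramSchmidtTrivialization, fun b => ⟨?_, ?_, ?_, ?_⟩, fun b b' => ?_⟩
    · exact FiberBundle.mem_baseSet_trivializationAt' b
    · refine ((trivializationAt (ModelO n k) (TangentSpace 𝓘(ℝ, ModelO n k) (M := OQuot n k))
        b).contMDiffOn (n := ω) (IB := 𝓘(ℝ, ModelO n k))).comp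
        (tangentDiffeomorph n k).symm.contMDiff.contMDiffOn ?_
      exact fun y hy => hy
    · exact (tangentDiffeomorph n k).contMDiff.comp_contMDiffOn
        ((trivializationAt (ModelO n k) (TangentSpace 𝓘(ℝ, ModelO n k) (M := OQuot n k))
          b).contMDiffOn_symm (n := ω) (IB := 𝓘(ℝ, ModelO n k)))
    · intro x hx
      have hlin := (((trivializationAt (ModelO n k)
        (TangentSpace 𝓘(ℝ, ModelO n k) (M := OQuot n k)) b).linear ℝ hx).mk'.comp
        (tangentFibreEquiv x).symm.toLinearMap).isLinear
      refine (congrArg (IsLinearMap ℝ) (funext fun z => ?_)).mp hlin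
      exact congrArg (fun p => (trivializationAt (ModelO n k)
        (TangentSpace 𝓘(ℝ, ModelO n k) (M := OQuot n k)) b p).2)
        (mk_tangentFibreEquiv_symm x z).symm
    · refine ⟨fun x => ((trivializationAt (ModelO n k)
        (TangentSpace 𝓘(ℝ, ModelO n k) (M := OQuot n k)) b).coordChangeL ℝ (trivializationAt
        (ModelO n k) (TangentSpace 𝓘(ℝ, ModelO n k) (M := OQuot n k)) b') x :
          ModelO n k →L[ℝ] ModelO n k), contMDiffOn_coordChangeL _ _, fun x hx v => ?_⟩
      refine (Bundle.Trivialization.coordChangeL_apply' (R := ℝ) _ _ hx v).trans ?_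
      exact congrArg (fun p => (trivializationAt (ModelO n k)
        (TangentSpace 𝓘(ℝ, ModelO n k) (M := OQuot n k)) b' p).2)
        ((tangentEquiv n k).symm_apply_apply _).symm

end bundle

end GramSchmidtBundle

theorem mainTheorem10 (n k : ℕ) (hn : 2 ≤ n) (hk : 1 ≤ k) (hkn : k ≤ n - 1) :
    -- the analytic structures of the two homogeneous spaces are the canonical quotient structures
    IsAnalyticSubmersion (E := ModelGL n k) (fun (W : GL (Fin n) ℝ) i j => W.1 i j)
      (QuotientGroup.mk : GL (Fin n) ℝ → GLQuot n k) ∧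
    IsAnalyticSubmersion (E := ModelO n k)
      (fun (V : Matrix.orthogonalGroup (Fin n) ℝ) i j => V.1 i j)
      (QuotientGroup.mk : Matrix.orthogonalGroup (Fin n) ℝ → OQuot n k) ∧
    -- the vector space structures on the fibres: the fibre over `x` is identified, through the
    -- idempotents, with an affine space of matrices, whose origin is the orthogonal projection
    Function.Injective (idem n k) ∧
    (∀ x : OQuot n k, idem n k '' (gramSchmidtMap n k ⁻¹' {x}) =
      {Q | Q * Q = Q ∧ LinearMap.range Q.mulVecLin = LinearMap.range (orthProj n k x).mulVecLin}) ∧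
    ∃ (_ : ∀ x : OQuot n k, AddCommGroup (gramSchmidtMap n k ⁻¹' {x}))
      (_ : ∀ x : OQuot n k, Module ℝ (gramSchmidtMap n k ⁻¹' {x})),
      (∀ x : OQuot n k, IsLinearMap ℝ
        fun a : gramSchmidtMap n k ⁻¹' {x} => idem n k a.1 - orthProj n k x) ∧
      -- the Gram-Schmidt map is an analytic vector bundle
      IsAnalyticVectorBundle (ModelO n k) 𝓘(ℝ, ModelO n k) 𝓘(ℝ, ModelGL n k)
        (gramSchmidtMap n k) ∧
      -- it is bi-analytically identified with the tangent bundle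
      ∃ (Φ : Diffeomorph 𝓘(ℝ, ModelO n k).tangent 𝓘(ℝ, ModelGL n k)
          (TangentBundle 𝓘(ℝ, ModelO n k) (OQuot n k)) (GLQuot n k) ω)
        (hΦ : ∀ v : TangentBundle 𝓘(ℝ, ModelO n k) (OQuot n k),
          gramSchmidtMap n k (Φ v) = v.proj),
        ∀ x : OQuot n k, IsLinearMap ℝ fun v : TangentSpace 𝓘(ℝ, ModelO n k) x =>
          (⟨Φ ⟨x, v⟩, hΦ ⟨x, v⟩⟩ : gramSchmidtMap n k ⁻¹' {x}) := by
  refine ⟨isAnalyticSubmersion_GL, isAnalyticSubmersion_O, idem_injective, idem_image_fibre,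
    fibreAddCommGroup, fibreModule, isLinearMap_idem_sub, isAnalyticVectorBundle_gramSchmidtMap,
    tangentDiffeomorph n k, gramSchmidtMap_tangentEquiv, fun x => ?_⟩
  -- On the fibre over `x`, `Φ` is `tangentFibreEquiv x` by definition.
  exact (tangentFibreEquiv x).toLinearMap.isLinear
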